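/- Let $\mathbb{D}$ be the unit disk with the metric $4|dz|^2/(1-|z|^2)^2$, origin $\mathcal{O}=0$ and Laplacian $\Delta=\frac14(1-|z|^2)^2\left(\partial_x^2+\partial_y^2\right)$. Let $s\in\mathbb{C}$ with $\operatorname{Re}s=\frac12$. For $r>0$ and $I\subset\mathbb{S}^1$ let $$\mathcal{C}(\mathcal{O},r,I)=\{\tanh(\tfrac r2)\,\xi:\ \xi\in I\},$$ the arc at hyperbolic distance $r$ from $\mathcal{O}$ delimited at infinity by $I$; on it the hyperbolic arc length is $|dz|_{\mathbb{D}}=\sinh(r)\,d\theta$ and $\frac{\partial}{\partial n}=\frac{\partial}{\partial r}$ denotes the exterior normal derivative. There is a constant $c(s)\neq0$, depending only on $s$, such that the following holds for every bounded $C^2$ function $f:\mathbb{D}\to\mathbb{C}$ with $\Delta f=-s(1-s)f$. For an interval $I\subset\mathbb{S}^1$ and a function $\psi:I\to\mathbb{C}$ that is $C^1$ on the closure of $I$ (it extends to a $C^1$ function on the closure of $I$ in $\mathbb{S}^1$), regarded as zero outside $I$, put $$\int\psi(\xi)\,\mathcal{D}_{f,s}(\xi):=\lim_{r\to+\infty}\frac1{c(s)}\int_{\mathcal{C}(\mathcal{O},r,I)}\psi(z)\,e^{-sr}\left(\frac{\partial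 f}{\partial n}+sf\right)|dz|_{\mathbb{D}},\qquad(1)$$ where $\psi(z)$ is any $C^1$ function on a neighbourhood of $\mathbb{S}^1$ in $\mathbb{C}$ that agrees with $\psi$ on $I$. 0. (Normalization and primitive.) For $I=\mathbb{S}^1$ and $\psi=1$ the limit (1) exists and equals $f(0)$. The limit $$\tilde{\mathcal{D}}_{f,s}(\alpha):=\lim_{r\to+\infty}\frac1{c(s)}\int_0^\alpha e^{-sr}\left(\frac{\partial f}{\partial n}+sf\right)\left(\tanh(\tfrac r2)e^{i\theta}\right)\sinh(r)\,d\theta$$ exists uniformly in $\alpha\in[0,2\pi]$, and $\tilde{\mathcal{D}}_{f,s}$ is $\frac12$-Hölder continuous on $[0,2\pi]$. 1. For every interval $I\subset\mathbb{S}^1$ and every $\psi:I\to\mathbb{C}$ that is $C^1$ on the closure of $I$, such extensions $\psi(z)$ exist, and the limit (1) exists and does not depend on the choice of the extension. 2. For all $0\le\alpha<\beta\le2\pi$ and every $C^1$ function $\psi$ on $I=\{e^{i\theta}:\alpha\le\theta\le\beta\}$, with $\tilde\psi(\theta)=\psi(e^{i\theta})$, $$\int\psi(\xi)\,\mathcal{D}_{f,s}(\xi)=\tilde\psi(\beta)\tilde{\mathcal{D}}_{f,s}(\beta)-\tilde\psi(\alpha)\tilde{\mathcal{D}}_{f,s}(\alpha)-\int_\alpha^\beta\frac{\partial\tilde\psi}{\partial\theta}(\theta)\,\tilde{\mathcal{D}}_{f,s}(\theta)\,d\theta.$$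 -/

import Mathlib

open Set Filter Topology

noncomputable section

namespace HelgasonDisk

/-- The point at infinity `e^{iθ}` of the unit circle. -/
def bdry (θ : ℝ) : ℂ := Complex.exp (θ * Complex.I)

/-- The point of the disk with geodesic polar coordinates `(r, θ)` at the origin `O = 0`, for the
metric `4|dz|² / (1 - |z|²)²`: it lies at hyperbolic distance `r` from `O`. -/
def polar (r θ : ℝ) : ℂ := (Real.tanh (r / 2) : ℂ) * bdry θ

/-- The Laplace operator `(1/4) (1 - |z|²)² (∂²/∂x² + ∂²/∂y²)` of the Poincaré disk. -/
def hypLaplacian (f : ℂ → ℂ) (z : ℂ) : ℂ :=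
  (((1 - ‖z‖ ^ 2) ^ 2 / 4 : ℝ) : ℂ) * Laplacian.laplacian f z

/-- `f` is a bounded `C²` function on the unit disk with `Δ f = -s (1 - s) f`
(the values of `f` outside the open disk play no role). -/
structure IsBoundedEigenfunction (s : ℂ) (f : ℂ → ℂ) : Prop where
  contDiffOn : ContDiffOn ℝ 2 f (Metric.ball 0 1)
  bounded : ∃ M : ℝ, ∀ z ∈ Metric.ball (0 : ℂ) 1, ‖f z‖ ≤ M
  eigen : ∀ z ∈ Metric.ball (0 : ℂ) 1, hypLaplacian f z = -(s * (1 - s)) * f z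

/-- The exterior normal derivative `∂f/∂n = ∂f/∂r` to the circle of hyperbolic radius `r`
centred at `O`, at the point with polar coordinates `(r, θ)`. -/
def normalDeriv (f : ℂ → ℂ) (r θ : ℝ) : ℂ := deriv (fun ρ : ℝ => f (polar ρ θ)) r

/-- The density `e^{-sr} (∂f/∂n + s f) sinh r` of `e^{-sr} (∂f/∂n + s f) |dz|_𝔻` with respect
to `dθ` on the circle of hyperbolic radius `r`, where `|dz|_𝔻 = sinh r dθ`. -/
def density (s : ℂ) (f : ℂ → ℂ) (r θ : ℝ) : ℂ :=
  Complex.exp (-s * r) * (normalDeriv f r θ + s * f (polar r θ)) * (Real.sinh r : ℂ)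

/-- The arc `C(O, r, I)`: points at hyperbolic distance `r` from `O` (that is, of modulus
`tanh (r / 2)`) on a geodesic ray from `O` (that is, a Euclidean radius) ending in `I`. -/
def arc (r : ℝ) (I : Set ℂ) : Set ℂ :=
  {z | ‖z‖ = Real.tanh (r / 2) ∧ ∃ ξ ∈ I, ∃ t ∈ Ico (0 : ℝ) 1, z = (t : ℂ) * ξ}

/-- `∫_{C(O,r,I)} Ψ(z) e^{-sr} (∂f/∂n + s f) |dz|_𝔻`, the circle of radius `r` being
parametrized once by `θ ∈ (0, 2π]`. -/
def arcIntegral (s : ℂ) (f : ℂ → ℂ) (I : Set ℂ) (Ψ : ℂ → ℂ) (r : ℝ) : ℂ :=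
  ∫ θ in {θ : ℝ | θ ∈ Ioc 0 (2 * Real.pi) ∧ polar r θ ∈ arc r I},
    Ψ (polar r θ) * density s f r θ

/-- Intervals of the unit circle (open, closed, half-open, possibly degenerate or all of the
circle): images of the intervals of the real line under `θ ↦ e^{iθ}`. -/
def IsCircleInterval (I : Set ℂ) : Prop :=
  ∃ J : Set ℝ, J.OrdConnected ∧ I = bdry '' J

/-- `ψ : I → ℂ` is `C¹` on the closure of `I`, that is, it extends to a function that is `C¹` on
the closure of `I`. Only the values of `ψ` on `I` matter. -/
def IsC1OnClosure (I : Set ℂ) (ψ : ℂ → ℂ) : Prop :=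
  ∃ φ : ℂ → ℂ, ContDiffOn ℝ 1 φ (closure I) ∧ EqOn φ ψ I

/-- `Ψ` is a `C¹` extension of `ψ : I → ℂ` to a neighbourhood of the unit circle. -/
def IsC1Extension (I : Set ℂ) (ψ Ψ : ℂ → ℂ) : Prop :=
  (∃ U : Set ℂ, IsOpen U ∧ Metric.sphere 0 1 ⊆ U ∧ ContDiffOn ℝ 1 Ψ U) ∧ EqOn Ψ ψ I

/-- `L` is the value `∫ ψ 1_I D_{f,s}`: there are `C¹` extensions `Ψ` of `ψ`, and for each of them
`(1/c) ∫_{C(O,r,I)} Ψ(z) e^{-sr} (∂f/∂n + s f) |dz|_𝔻` tends to `L` as `r → ∞`. -/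
def IsHelgasonIntegral (s c : ℂ) (f : ℂ → ℂ) (I : Set ℂ) (ψ : ℂ → ℂ) (L : ℂ) : Prop :=
  (∃ Ψ : ℂ → ℂ, IsC1Extension I ψ Ψ) ∧
    ∀ Ψ : ℂ → ℂ, IsC1Extension I ψ Ψ →
      Tendsto (fun r : ℝ => 1 / c * arcIntegral s f I Ψ r) atTop (𝓝 L)

/-- `c` is a normalizing constant: it is nonzero, depends only on `s`, and gives
`⟨D_{f,s}, 1⟩ = f(0)` for every bounded `C²` eigenfunction `f`. -/
def IsNormalizing (s c : ℂ) : Prop :=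
  c ≠ 0 ∧ ∀ f : ℂ → ℂ, IsBoundedEigenfunction s f →
    IsHelgasonIntegral s c f (Metric.sphere 0 1) (fun _ => 1) (f 0)

/-- `(1/c) ∫_0^α e^{-sr} (∂f/∂n + s f)(tanh(r/2) e^{iθ}) sinh r dθ`. -/
def partialPrimitive (s c : ℂ) (f : ℂ → ℂ) (r α : ℝ) : ℂ :=
  1 / c * ∫ θ in (0 : ℝ)..α, density s f r θ

/-- The primitive `D̃_{f,s}(α)` of the Helgason distribution: the limit of
`partialPrimitive s c f r α` as `r → ∞`. -/
def primitive (s c : ℂ) (f : ℂ → ℂ) (α : ℝ) : ℂ :=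
  limUnder atTop (fun r : ℝ => partialPrimitive s c f r α)

end HelgasonDisk

end

noncomputable section

namespace HelgasonDisk

/-! ### The boundary parametrization -/

/-! The density e^{-sr} (∂_r f + s f) sinh r is built so that the eigenfunction equation in polar
coordinates turns its radial derivative into e^{-sr} (s e^{-r} f - ∂_θ² f / sinh r). Integrated over
[0, α], the second angular derivative leaves only boundary values of ∂_θ f / sinh r. An interior
gradient estimate on discs of Euclidean radius comparable to 1 - |z| bounds f, ∂_r f and ∂_θ f /
sinh r uniformly (`exists_derivative_bounds`), and |e^{-sr}| = e^{-r/2} because Re s = 1/2. Hence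
the primitives of the density converge as r → ∞ with error O(e^{-r/2}) (`exists_limit`), while the
density itself is O(e^{r/2}). Balancing the two at e^{-r} ≈ |α - β| gives the Hölder exponent 1/2.

For the constant, circular means of f solve the radial equation, and a solution regular at the
origin is determined by its value there, by a decreasing energy. The total mass is therefore f(0)
times a number depending only on s. That number is nonzero because the squared modulus of the
outgoing component obeys a differential inequality which keeps it away from zero
(`exists_le_outgoing`).

For a C¹ weight, integration by parts on the circle of radius r replaces the density by its
primitive, and dominated convergence yields the Stieltjes expression `stieltjes`
(`tendsto_integral_mul_density`). This expression only sees the weight on the closed arc, so it is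
the same for all extensions (`IsArcOf.stieltjes_eq`). What remains is geometry: writing arc
integrals as integrals over one interval (`IsArcOf.arcIntegral_eq`) and constructing extensions
(`IsArcOf.exists_extension`). -/

lemma hasDerivAt_bdry (θ : ℝ) : HasDerivAt bdry (Complex.I * bdry θ) θ := by
  have h : HasDerivAt (fun t : ℝ => (t : ℂ) * Complex.I) (1 * Complex.I) θ :=
    (Complex.ofRealCLM.hasDerivAt (x := θ)).mul_const Complex.I
  have := h.cexp
  rw [one_mul, mul_comm] at this
  exact this

lemma contDiff_bdry {n : ℕ∞} : ContDiff ℝ n bdry := by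
  unfold bdry
  have : ContDiff ℝ n (fun t : ℝ => (t : ℂ)) := Complex.ofRealCLM.contDiff
  exact (this.mul contDiff_const).cexp

@[fun_prop]
lemma continuous_bdry : Continuous bdry := by
  unfold bdry; fun_prop

@[simp] lemma norm_bdry (θ : ℝ) : ‖bdry θ‖ = 1 := Complex.norm_exp_ofReal_mul_I θ

lemma bdry_ne_zero (θ : ℝ) : bdry θ ≠ 0 := Complex.exp_ne_zero _

lemma bdry_eq (θ : ℝ) : bdry θ = (Real.cos θ : ℂ) + (Real.sin θ : ℂ) * Complex.I := by
  simp [bdry, Complex.exp_mul_I]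

@[simp] lemma bdry_zero : bdry 0 = 1 := by simp [bdry]

lemma bdry_periodic : Function.Periodic bdry (2 * Real.pi) := by
  intro θ
  simp only [bdry]
  push_cast
  rw [add_mul, Complex.exp_add, Complex.exp_two_pi_mul_I, mul_one]

@[simp] lemma bdry_two_pi : bdry (2 * Real.pi) = 1 := by
  simpa using bdry_periodic 0

/-! ### Polar calculus for `C²` functions -/

lemma map_ofReal_mul (L : ℂ →L[ℝ] ℂ) (t : ℝ) (v : ℂ) : L ((t : ℂ) * v) = (t : ℂ) * L v := by
  rw [← Complex.real_smul, map_smul, Complex.real_smul]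

lemma map_ofReal_mul' (L : ℂ →L[ℝ] ℂ →L[ℝ] ℂ) (t : ℝ) (v w : ℂ) :
    L ((t : ℂ) * v) w = (t : ℂ) * L v w := by
  rw [← Complex.real_smul, map_smul, smul_apply, Complex.real_smul]

section C2

variable {f : ℂ → ℂ} {S : Set ℂ}

lemma hasFDerivAt_of_C2 (hS : IsOpen S) (hf : ContDiffOn ℝ 2 f S) {z : ℂ} (hz : z ∈ S) :
    HasFDerivAt f (fderiv ℝ f z) z :=
  ((hf.contDiffAt (hS.mem_nhds hz)).differentiableAt (by norm_num)).hasFDerivAt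

lemma contDiffOn_fderiv (hS : IsOpen S) (hf : ContDiffOn ℝ 2 f S) :
    ContDiffOn ℝ 1 (fderiv ℝ f) S :=
  hf.fderiv_of_isOpen hS (by norm_num)

lemma hasFDerivAt_fderiv_of_C2 (hS : IsOpen S) (hf : ContDiffOn ℝ 2 f S) {z : ℂ} (hz : z ∈ S) :
    HasFDerivAt (fderiv ℝ f) (fderiv ℝ (fderiv ℝ f) z) z :=
  (((contDiffOn_fderiv hS hf).contDiffAt (hS.mem_nhds hz)).differentiableAt
    (by norm_num)).hasFDerivAt

lemma continuousOn_fderiv_fderiv (hS : IsOpen S) (hf : ContDiffOn ℝ 2 f S) :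
    ContinuousOn (fderiv ℝ (fderiv ℝ f)) S :=
  (contDiffOn_fderiv hS hf).continuousOn_fderiv_of_isOpen hS (by norm_num)

/-- The Laplacian is the trace of the second derivative in any rotated frame. -/
lemma second_fderiv_rotated_frame (f : ℂ → ℂ) (z : ℂ) (θ : ℝ) :
    fderiv ℝ (fderiv ℝ f) z (bdry θ) (bdry θ) +
      fderiv ℝ (fderiv ℝ f) z (Complex.I * bdry θ) (Complex.I * bdry θ) =
      Laplacian.laplacian f z := by
  rw [InnerProductSpace.laplacian_eq_iteratedFDeriv_complexPlane]
  simp only [iteratedFDeriv_two_apply, Matrix.cons_val_zero, Matrix.cons_val_one]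
  set D := fderiv ℝ (fderiv ℝ f) z
  have e1 : bdry θ = Real.cos θ • (1 : ℂ) + Real.sin θ • Complex.I := by
    rw [bdry_eq]; simp
  have e2 : Complex.I * bdry θ = Real.cos θ • Complex.I - Real.sin θ • (1 : ℂ) := by
    rw [bdry_eq]
    simp only [Complex.real_smul]
    linear_combination (Real.sin θ : ℂ) * Complex.I_mul_I
  rw [e2, e1]
  simp only [Complex.real_smul, map_add, map_sub, add_apply, sub_apply, map_ofReal_mul,
    map_ofReal_mul']
  have h : (Real.cos θ : ℂ) ^ 2 + (Real.sin θ : ℂ) ^ 2 = 1 := by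
    exact_mod_cast Real.cos_sq_add_sin_sq θ
  linear_combination (D 1 1 + D Complex.I Complex.I) * h

lemma hasDerivAt_ray_point {τ : ℝ → ℝ} {τ' r : ℝ} (hτ : HasDerivAt τ τ' r) (z₀ e : ℂ) :
    HasDerivAt (fun r : ℝ => z₀ + (τ r : ℂ) * e) ((τ' : ℂ) * e) r :=
  ((hτ.ofReal_comp).mul_const e).const_add z₀

lemma hasDerivAt_circle_point (t : ℝ) (z₀ : ℂ) (θ : ℝ) :
    HasDerivAt (fun θ : ℝ => z₀ + (t : ℂ) * bdry θ) ((t : ℂ) * (Complex.I * bdry θ)) θ :=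
  ((hasDerivAt_bdry θ).const_mul (t : ℂ)).const_add z₀

lemma hasDerivAt_ray (hS : IsOpen S) (hf : ContDiffOn ℝ 2 f S) {τ : ℝ → ℝ} {τ' r : ℝ}
    (hτ : HasDerivAt τ τ' r) {z₀ e : ℂ} (hz : z₀ + (τ r : ℂ) * e ∈ S) :
    HasDerivAt (fun r : ℝ => f (z₀ + (τ r : ℂ) * e))
      ((τ' : ℂ) * fderiv ℝ f (z₀ + (τ r : ℂ) * e) e) r := by
  have := (hasFDerivAt_of_C2 hS hf hz).comp_hasDerivAt r (hasDerivAt_ray_point hτ z₀ e)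
  rwa [map_ofReal_mul] at this

lemma hasDerivAt_fderiv_ray (hS : IsOpen S) (hf : ContDiffOn ℝ 2 f S) {τ : ℝ → ℝ} {τ' r : ℝ}
    (hτ : HasDerivAt τ τ' r) {z₀ e : ℂ} (hz : z₀ + (τ r : ℂ) * e ∈ S) :
    HasDerivAt (fun r : ℝ => fderiv ℝ f (z₀ + (τ r : ℂ) * e) e)
      ((τ' : ℂ) * fderiv ℝ (fderiv ℝ f) (z₀ + (τ r : ℂ) * e) e e) r := by
  have := (hasFDerivAt_fderiv_of_C2 hS hf hz).comp_hasDerivAt r (hasDerivAt_ray_point hτ z₀ e)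
  have := this.clm_apply (hasDerivAt_const r e)
  simpa [map_ofReal_mul'] using this

lemma hasDerivAt_circle (hS : IsOpen S) (hf : ContDiffOn ℝ 2 f S) {t : ℝ} {z₀ : ℂ} {θ : ℝ}
    (hz : z₀ + (t : ℂ) * bdry θ ∈ S) :
    HasDerivAt (fun θ : ℝ => f (z₀ + (t : ℂ) * bdry θ))
      ((t : ℂ) * fderiv ℝ f (z₀ + (t : ℂ) * bdry θ) (Complex.I * bdry θ)) θ := by
  have := (hasFDerivAt_of_C2 hS hf hz).comp_hasDerivAt θ (hasDerivAt_circle_point t z₀ θ)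
  rwa [map_ofReal_mul] at this

/-- The second angular derivative of `f` on the circle of centre `z₀` and radius `t`. -/
def angularSecond (f : ℂ → ℂ) (z₀ : ℂ) (t θ : ℝ) : ℂ :=
  (t : ℂ) ^ 2 * fderiv ℝ (fderiv ℝ f) (z₀ + (t : ℂ) * bdry θ) (Complex.I * bdry θ)
      (Complex.I * bdry θ) -
    (t : ℂ) * fderiv ℝ f (z₀ + (t : ℂ) * bdry θ) (bdry θ)

lemma hasDerivAt_fderiv_circle (hS : IsOpen S) (hf : ContDiffOn ℝ 2 f S) {t : ℝ} {z₀ : ℂ} {θ : ℝ}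
    (hz : z₀ + (t : ℂ) * bdry θ ∈ S) :
    HasDerivAt (fun θ : ℝ =>
        (t : ℂ) * fderiv ℝ f (z₀ + (t : ℂ) * bdry θ) (Complex.I * bdry θ))
      (angularSecond f z₀ t θ) θ := by
  have h := (hasFDerivAt_fderiv_of_C2 hS hf hz).comp_hasDerivAt θ (hasDerivAt_circle_point t z₀ θ)
  have h2 := (h.clm_apply ((hasDerivAt_bdry θ).const_mul Complex.I)).const_mul (t : ℂ)
  refine h2.congr_deriv ?_
  have : Complex.I * (Complex.I * bdry θ) = - bdry θ := by
    rw [← mul_assoc, Complex.I_mul_I]; ring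
  simp only [Function.comp, map_ofReal_mul', this, map_neg, angularSecond]
  ring

end C2

/-- Differentiation under the integral sign for jointly continuous integrands. -/
lemma hasDerivAt_integral_of_continuousOn {F F' : ℝ → ℝ → ℂ} {O : Set ℝ} (hO : IsOpen O)
    (a b : ℝ) (hF : ContinuousOn (Function.uncurry F) (O ×ˢ univ))
    (hF' : ContinuousOn (Function.uncurry F') (O ×ˢ univ))
    (hd : ∀ r ∈ O, ∀ θ, HasDerivAt (fun r => F r θ) (F' r θ) r) {r : ℝ} (hr : r ∈ O) :
    HasDerivAt (fun r => ∫ θ in a..b, F r θ) (∫ θ in a..b, F' r θ) r := by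
  obtain ⟨ε, hε, hεO⟩ := Metric.nhds_basis_closedBall.mem_iff.1 (hO.mem_nhds hr)
  have hcomp : IsCompact (Metric.closedBall r ε ×ˢ uIcc a b) :=
    (isCompact_closedBall r ε).prod isCompact_uIcc
  obtain ⟨C, hC⟩ := hcomp.exists_bound_of_continuousOn
    (hF'.mono (prod_mono hεO (subset_univ _)))
  have slice : ∀ {G : ℝ → ℝ → ℂ}, ContinuousOn (Function.uncurry G) (O ×ˢ univ) →
      ∀ x ∈ O, Continuous (G x) := by
    intro G hG x hx
    rw [← continuousOn_univ]
    exact hG.comp (f := fun θ : ℝ => (x, θ)) (by fun_prop) (fun θ _ => ⟨hx, mem_univ _⟩)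
  refine (intervalIntegral.hasDerivAt_integral_of_dominated_loc_of_deriv_le
    (s := Metric.closedBall r ε) (bound := fun _ => C) (Metric.closedBall_mem_nhds r hε)
    ?_ ?_ ?_ ?_ ?_ ?_).2
  · filter_upwards [hO.mem_nhds hr] with x hx
    exact (slice hF x hx).aestronglyMeasurable
  · exact (slice hF r hr).intervalIntegrable _ _
  · exact (slice hF' r hr).aestronglyMeasurable
  · refine Eventually.of_forall fun t ht x hx => ?_
    exact hC (x, t) ⟨hx, uIoc_subset_uIcc ht⟩
  · exact intervalIntegrable_const
  · exact Eventually.of_forall fun t _ x hx => hd x (hεO hx) t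

/-! ### An interior gradient estimate for the Poisson equation -/

section Gradient

variable {f : ℂ → ℂ} {z₀ : ℂ} {R : ℝ}

lemma polar_mem_ball {t : ℝ} (ht : t ∈ Ioo (-R) R) (θ : ℝ) :
    z₀ + (t : ℂ) * bdry θ ∈ Metric.ball z₀ R := by
  simpa [abs_lt] using ht

lemma continuousOn_comp_polar {E : Type*} [TopologicalSpace E] {g : ℂ → E}
    (hg : ContinuousOn g (Metric.ball z₀ R)) :
    ContinuousOn (fun p : ℝ × ℝ => g (z₀ + (p.1 : ℂ) * bdry p.2)) (Ioo (-R) R ×ˢ univ) :=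
  hg.comp (by fun_prop) fun p hp => polar_mem_ball hp.1 p.2

/-- The weighted circular means of a `C²` function with small Laplacian are almost linear in the
radius, for a weight `w` with `w'' = -w`. -/
lemma norm_integral_weight_mul_fderiv_le (hR : 0 < R) (hf : ContDiffOn ℝ 2 f (Metric.ball z₀ R))
    {M K : ℝ} (hM : ∀ z ∈ Metric.ball z₀ R, ‖f z‖ ≤ M)
    (hK : ∀ z ∈ Metric.ball z₀ R, ‖Laplacian.laplacian f z‖ ≤ K)
    {w w' : ℝ → ℝ} (hw : ∀ θ, HasDerivAt w (w' θ) θ) (hw' : ∀ θ, HasDerivAt w' (-w θ) θ)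
    (hw1 : ∀ θ, |w θ| ≤ 1) (hp : w (2 * Real.pi) = w 0) (hp' : w' (2 * Real.pi) = w' 0) :
    ‖∫ θ in (0 : ℝ)..2 * Real.pi, (w θ : ℂ) * fderiv ℝ f z₀ (bdry θ)‖ ≤
      2 * Real.pi * (2 * M / R + K * R) := by
  have hB := Metric.isOpen_ball (x := z₀) (ε := R)
  have hz₀ : z₀ ∈ Metric.ball z₀ R := Metric.mem_ball_self hR
  have hM0 : 0 ≤ M := (norm_nonneg _).trans (hM z₀ hz₀)
  have hK0 : 0 ≤ K := (norm_nonneg _).trans (hK z₀ hz₀)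
  have hwc : Continuous w := continuous_iff_continuousAt.2 fun θ => (hw θ).continuousAt
  have hwc' : Continuous w' := continuous_iff_continuousAt.2 fun θ => (hw' θ).continuousAt
  have hpi := Real.pi_pos
  have c0 := continuousOn_comp_polar hf.continuousOn
  have c1 := continuousOn_comp_polar (contDiffOn_fderiv hB hf).continuousOn
  have c2 := continuousOn_comp_polar (continuousOn_fderiv_fderiv hB hf)
  have cw : ContinuousOn (fun p : ℝ × ℝ => (w p.2 : ℂ)) (Ioo (-R) R ×ˢ univ) := by fun_prop
  have cb : ContinuousOn (fun p : ℝ × ℝ => bdry p.2) (Ioo (-R) R ×ˢ univ) := by fun_prop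
  have cib : ContinuousOn (fun p : ℝ × ℝ => Complex.I * bdry p.2) (Ioo (-R) R ×ˢ univ) := by
    fun_prop
  have cr : ContinuousOn (fun p : ℝ × ℝ => (p.1 : ℂ)) (Ioo (-R) R ×ˢ univ) := by fun_prop
  have cr2 : ContinuousOn (fun p : ℝ × ℝ => (p.1 : ℂ) ^ 2) (Ioo (-R) R ×ˢ univ) := by fun_prop
  have slice : ∀ {E : Type} [TopologicalSpace E] {G : ℝ × ℝ → E},
      ContinuousOn G (Ioo (-R) R ×ˢ univ) →
      ∀ x ∈ Ioo (-R) R, Continuous (fun θ => G (x, θ)) := by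
    intro E _ G hG x hx
    rw [← continuousOn_univ]
    exact hG.comp (f := fun θ : ℝ => (x, θ)) (by fun_prop) (fun θ _ => ⟨hx, mem_univ _⟩)
  -- the circular mean `a` and its derivative
  set fr : ℝ → ℝ → ℂ := fun ρ θ => fderiv ℝ f (z₀ + (ρ : ℂ) * bdry θ) (bdry θ) with hfr
  set frr : ℝ → ℝ → ℂ := fun ρ θ =>
    fderiv ℝ (fderiv ℝ f) (z₀ + (ρ : ℂ) * bdry θ) (bdry θ) (bdry θ) with hfrr
  have cfr : ContinuousOn (Function.uncurry fr) (Ioo (-R) R ×ˢ univ) := c1.clm_apply cb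
  have cfrr : ContinuousOn (Function.uncurry frr) (Ioo (-R) R ×ˢ univ) :=
    (c2.clm_apply cb).clm_apply cb
  have dfr : ∀ ρ ∈ Ioo (-R) R, ∀ θ,
      HasDerivAt (fun ρ : ℝ => f (z₀ + (ρ : ℂ) * bdry θ)) (fr ρ θ) ρ := by
    intro ρ hρ θ
    simpa using hasDerivAt_ray hB hf (hasDerivAt_id ρ) (polar_mem_ball hρ θ)
  have dfrr : ∀ ρ ∈ Ioo (-R) R, ∀ θ, HasDerivAt (fun ρ : ℝ => fr ρ θ) (frr ρ θ) ρ := by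
    intro ρ hρ θ
    simpa using hasDerivAt_fderiv_ray hB hf (hasDerivAt_id ρ) (polar_mem_ball hρ θ)
  set a : ℝ → ℂ := fun ρ => ∫ θ in (0 : ℝ)..2 * Real.pi, (w θ : ℂ) * f (z₀ + (ρ : ℂ) * bdry θ)
    with ha
  set a' : ℝ → ℂ := fun ρ => ∫ θ in (0 : ℝ)..2 * Real.pi, (w θ : ℂ) * fr ρ θ with ha'
  have da : ∀ ρ ∈ Ioo (-R) R, HasDerivAt a (a' ρ) ρ := fun ρ hρ =>
    hasDerivAt_integral_of_continuousOn (F := fun ρ θ => (w θ : ℂ) * f (z₀ + (ρ : ℂ) * bdry θ))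
      (F' := fun ρ θ => (w θ : ℂ) * fr ρ θ) isOpen_Ioo 0 _ (cw.mul c0) (cw.mul cfr)
      (fun r hr θ => (dfr r hr θ).const_mul _) hρ
  -- Here B = ρ² a' - ρ a = ρ³ (a / ρ)'. Its derivative ρ² a'' + ρ a' - a is the weighted mean of ρ²
  -- Δf, because w'' = -w turns the angular part of the Laplacian into -a.
  set B : ℝ → ℂ := fun ρ => ∫ θ in (0 : ℝ)..2 * Real.pi,
    (w θ : ℂ) * ((ρ : ℂ) ^ 2 * fr ρ θ - (ρ : ℂ) * f (z₀ + (ρ : ℂ) * bdry θ)) with hBdef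
  have dB : ∀ ρ ∈ Ioo (-R) R, HasDerivAt B (∫ θ in (0 : ℝ)..2 * Real.pi,
      (w θ : ℂ) * ((ρ : ℂ) ^ 2 * frr ρ θ + (ρ : ℂ) * fr ρ θ - f (z₀ + (ρ : ℂ) * bdry θ))) ρ := by
    intro ρ hρ
    refine hasDerivAt_integral_of_continuousOn
      (F := fun ρ θ => (w θ : ℂ) * ((ρ : ℂ) ^ 2 * fr ρ θ - (ρ : ℂ) * f (z₀ + (ρ : ℂ) * bdry θ)))
      (F' := fun ρ θ => (w θ : ℂ) * ((ρ : ℂ) ^ 2 * frr ρ θ + (ρ : ℂ) * fr ρ θ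
        - f (z₀ + (ρ : ℂ) * bdry θ))) isOpen_Ioo 0 _
      (cw.fun_mul ((cr2.fun_mul cfr).fun_sub (cr.fun_mul c0)))
      (cw.fun_mul (((cr2.fun_mul cfrr).fun_add (cr.fun_mul cfr)).fun_sub c0)) ?_ hρ
    intro r hr θ
    have hid : HasDerivAt (fun r : ℝ => (r : ℂ)) 1 r := Complex.ofRealCLM.hasDerivAt
    refine ((((hid.fun_pow 2).mul (dfrr r hr θ)).sub (hid.mul (dfr r hr θ))).const_mul
      (w θ : ℂ)).congr_deriv ?_
    simp only [Nat.cast_ofNat, Nat.add_one_sub_one, pow_one, mul_one, one_mul]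
    ring
  have B_deriv_eq : ∀ ρ ∈ Ioo (-R) R, (∫ θ in (0 : ℝ)..2 * Real.pi,
      (w θ : ℂ) * ((ρ : ℂ) ^ 2 * frr ρ θ + (ρ : ℂ) * fr ρ θ - f (z₀ + (ρ : ℂ) * bdry θ))) =
      ∫ θ in (0 : ℝ)..2 * Real.pi, (w θ : ℂ) * ((ρ : ℂ) ^ 2 *
        Laplacian.laplacian f (z₀ + (ρ : ℂ) * bdry θ)) := by
    intro ρ hρ
    have hfθθ : Continuous (fun θ => angularSecond f z₀ ρ θ) := by
      have h1 := slice ((c2.clm_apply cib).clm_apply cib) ρ hρ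
      have h2 := slice (c1.clm_apply cb) ρ hρ
      exact (continuous_const.mul h1).sub (continuous_const.mul h2)
    -- The integrand is the exact derivative of w ∂_θ f - w' f, which takes the same value at 0 and
    -- 2π.
    have hftc : ∫ θ in (0 : ℝ)..2 * Real.pi, (w θ : ℂ) * (angularSecond f z₀ ρ θ
        + f (z₀ + (ρ : ℂ) * bdry θ)) = 0 := by
      have hd : ∀ θ ∈ uIcc 0 (2 * Real.pi), HasDerivAt (fun θ : ℝ =>
          (w θ : ℂ) * ((ρ : ℂ) * fderiv ℝ f (z₀ + (ρ : ℂ) * bdry θ) (Complex.I * bdry θ))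
            - (w' θ : ℂ) * f (z₀ + (ρ : ℂ) * bdry θ))
          ((w θ : ℂ) * (angularSecond f z₀ ρ θ + f (z₀ + (ρ : ℂ) * bdry θ))) θ := by
        intro θ _
        refine (((hw θ).ofReal_comp.mul (hasDerivAt_fderiv_circle hB hf
          (polar_mem_ball hρ θ))).sub ((hw' θ).ofReal_comp.mul (hasDerivAt_circle hB hf
          (polar_mem_ball hρ θ)))).congr_deriv ?_
        push_cast
        ring
      rw [intervalIntegral.integral_eq_sub_of_hasDerivAt hd]
      · simp [hp, hp']
      · have h0 := slice c0 ρ hρ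
        exact (((Complex.continuous_ofReal.comp hwc)).mul (hfθθ.add h0)).intervalIntegrable _ _
    have h0 := slice c0 ρ hρ
    have h1 := slice cfr ρ hρ
    have h2 := slice cfrr ρ hρ
    have hwC : Continuous fun θ => (w θ : ℂ) := by fun_prop
    rw [← sub_zero (∫ θ in (0 : ℝ)..2 * Real.pi, (w θ : ℂ) * ((ρ : ℂ) ^ 2 *
        Laplacian.laplacian f (z₀ + (ρ : ℂ) * bdry θ))), ← hftc, eq_sub_iff_add_eq,
      ← intervalIntegral.integral_add]
    · refine intervalIntegral.integral_congr fun θ _ => ?_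
      simp only [← second_fderiv_rotated_frame f (z₀ + (ρ : ℂ) * bdry θ) θ, angularSecond, hfr,
        hfrr]
      ring
    · exact (hwC.mul (((continuous_const.mul h2).add (continuous_const.mul h1)).sub
        h0)).intervalIntegrable _ _
    · exact (hwC.mul (hfθθ.add h0)).intervalIntegrable _ _
  have B_deriv_le : ∀ ρ ∈ Ioo (-R) R, ‖∫ θ in (0 : ℝ)..2 * Real.pi,
      (w θ : ℂ) * ((ρ : ℂ) ^ 2 * frr ρ θ + (ρ : ℂ) * fr ρ θ - f (z₀ + (ρ : ℂ) * bdry θ))‖ ≤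
      2 * Real.pi * K * ρ ^ 2 := by
    intro ρ hρ
    rw [B_deriv_eq ρ hρ]
    have := intervalIntegral.norm_integral_le_of_norm_le_const (a := 0) (b := 2 * Real.pi)
      (C := ρ ^ 2 * K) (f := fun θ => (w θ : ℂ) * ((ρ : ℂ) ^ 2 *
        Laplacian.laplacian f (z₀ + (ρ : ℂ) * bdry θ))) (by
        intro θ _
        rw [norm_mul, norm_mul, norm_pow, Complex.norm_real, Complex.norm_real, Real.norm_eq_abs,
          Real.norm_eq_abs, sq_abs]
        calc |w θ| * (ρ ^ 2 * ‖Laplacian.laplacian f (z₀ + (ρ : ℂ) * bdry θ)‖)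
            ≤ 1 * (ρ ^ 2 * K) := by
              gcongr
              · exact hw1 θ
              · exact hK _ (polar_mem_ball hρ θ)
          _ = _ := one_mul _)
    rw [sub_zero, abs_of_pos (by positivity)] at this
    linarith
  have B_le : ∀ ρ ∈ Ioo 0 R, ‖B ρ‖ ≤ 2 * Real.pi * K * ρ ^ 3 := by
    intro ρ hρ
    have hB0 : B 0 = 0 := by simp [hBdef]
    have := (convex_Icc 0 ρ).norm_image_sub_le_of_norm_hasDerivWithin_le (f := B)
      (C := 2 * Real.pi * K * ρ ^ 2) (x := 0) (y := ρ)
      (fun x hx => (dB x ⟨by linarith [hx.1], hx.2.trans_lt hρ.2⟩).hasDerivWithinAt)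
      (fun x hx => (B_deriv_le x ⟨by linarith [hx.1], hx.2.trans_lt hρ.2⟩).trans (by
        have := hx.1
        have := hx.2
        gcongr))
      ⟨le_rfl, hρ.1.le⟩ ⟨hρ.1.le, le_rfl⟩
    rw [hB0, sub_zero, sub_zero, Real.norm_eq_abs, abs_of_pos hρ.1] at this
    calc ‖B ρ‖ ≤ _ := this
      _ = _ := by ring
  have B_eq : ∀ ρ ∈ Ioo (-R) R, B ρ = (ρ : ℂ) ^ 2 * a' ρ - (ρ : ℂ) * a ρ := by
    intro ρ hρ
    have h0 := slice c0 ρ hρ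
    have h1 := slice cfr ρ hρ
    have hwC : Continuous fun θ => (w θ : ℂ) := by fun_prop
    simp only [hBdef, ha, ha']
    rw [← intervalIntegral.integral_const_mul, ← intervalIntegral.integral_const_mul,
      ← intervalIntegral.integral_sub]
    · refine intervalIntegral.integral_congr fun θ _ => ?_
      ring
    · exact (continuous_const.mul (hwC.mul h1)).intervalIntegrable _ _
    · exact (continuous_const.mul (hwC.mul h0)).intervalIntegrable _ _
  -- the quotient `a ρ / ρ`
  have dq : ∀ ρ ∈ Ioo 0 R, HasDerivAt (fun ρ : ℝ => a ρ / (ρ : ℂ)) (B ρ / (ρ : ℂ) ^ 3) ρ := by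
    intro ρ hρ
    have hρ' : ρ ∈ Ioo (-R) R := ⟨by linarith [hρ.1], hρ.2⟩
    have hid : HasDerivAt (fun r : ℝ => (r : ℂ)) 1 ρ := Complex.ofRealCLM.hasDerivAt
    have hne : (ρ : ℂ) ≠ 0 := by exact_mod_cast hρ.1.ne'
    refine ((da ρ hρ').div hid hne).congr_deriv ?_
    rw [B_eq ρ hρ']
    field_simp
  have dq_le : ∀ ρ ∈ Ioo 0 R, ‖B ρ / (ρ : ℂ) ^ 3‖ ≤ 2 * Real.pi * K := by
    intro ρ hρ
    rw [norm_div, norm_pow, Complex.norm_real, Real.norm_eq_abs, abs_of_pos hρ.1,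
      div_le_iff₀ (pow_pos hρ.1 3)]
    exact B_le ρ hρ
  -- The bound on (a / ρ)' is integrated from ρ to R / 2, a radius inside the open disc at which |a|
  -- ≤ 2πM.
  have q_le : ∀ ρ ∈ Ioo 0 (R / 2), ‖a ρ / (ρ : ℂ)‖ ≤ 2 * Real.pi * (2 * M / R + K * R) := by
    intro ρ hρ
    have h := (convex_Icc ρ (R / 2)).norm_image_sub_le_of_norm_hasDerivWithin_le
      (f := fun ρ : ℝ => a ρ / (ρ : ℂ)) (C := 2 * Real.pi * K) (x := R / 2) (y := ρ)
      (fun x hx => (dq x ⟨by linarith [hx.1, hρ.1], by linarith [hx.2]⟩).hasDerivWithinAt)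
      (fun x hx => dq_le x ⟨by linarith [hx.1, hρ.1], by linarith [hx.2]⟩)
      ⟨hρ.2.le, le_rfl⟩ ⟨le_rfl, hρ.2.le⟩
    have hd : ‖ρ - R / 2‖ ≤ R := by
      rw [Real.norm_eq_abs, abs_le]; constructor <;> linarith [hρ.1, hρ.2]
    have haR : ‖a (R / 2)‖ ≤ M * (2 * Real.pi) := by
      have := intervalIntegral.norm_integral_le_of_norm_le_const (a := 0) (b := 2 * Real.pi)
        (C := M) (f := fun θ => (w θ : ℂ) * f (z₀ + ((R / 2 : ℝ) : ℂ) * bdry θ)) (by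
          intro θ _
          rw [norm_mul, Complex.norm_real, Real.norm_eq_abs]
          calc |w θ| * ‖f (z₀ + ((R / 2 : ℝ) : ℂ) * bdry θ)‖ ≤ 1 * M := by
                gcongr
                · exact hw1 θ
                · exact hM _ (polar_mem_ball ⟨by linarith, by linarith⟩ θ)
            _ = M := one_mul _)
      rwa [sub_zero, abs_of_pos (by positivity)] at this
    have hqR : ‖a (R / 2) / ((R / 2 : ℝ) : ℂ)‖ ≤ 2 * Real.pi * (2 * M / R) := by
      rw [norm_div, Complex.norm_real, Real.norm_eq_abs, abs_of_pos (by positivity),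
        div_le_iff₀ (by positivity)]
      refine haR.trans (le_of_eq ?_)
      field_simp
    have h2 : ‖a ρ / (ρ : ℂ)‖ ≤ ‖a ρ / (ρ : ℂ) - a (R / 2) / ((R / 2 : ℝ) : ℂ)‖
        + ‖a (R / 2) / ((R / 2 : ℝ) : ℂ)‖ := by
      simpa using norm_add_le (a ρ / (ρ : ℂ) - a (R / 2) / ((R / 2 : ℝ) : ℂ))
        (a (R / 2) / ((R / 2 : ℝ) : ℂ))
    have h3 : 2 * Real.pi * K * ‖ρ - R / 2‖ ≤ 2 * Real.pi * K * R := by gcongr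
    linarith
  have ha0 : a 0 = (∫ θ in (0 : ℝ)..2 * Real.pi, (w θ : ℂ)) * f z₀ := by
    simp [ha]
  -- Since w = -w'', it has mean zero. Hence a vanishes at 0, and a ρ / ρ is a difference quotient
  -- with limit a' 0.
  have hw0 : ∫ θ in (0 : ℝ)..2 * Real.pi, (w θ : ℂ) = 0 := by
    rw [intervalIntegral.integral_ofReal, intervalIntegral.integral_eq_sub_of_hasDerivAt
      (f := fun θ => - w' θ) (fun θ _ => by simpa using (hw' θ).fun_neg)
      (hwc.intervalIntegrable _ _)]
    simp [hp']
  have hlim : Tendsto (fun ρ : ℝ => a ρ / (ρ : ℂ)) (𝓝[>] 0) (𝓝 (a' 0)) := by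
    have h := (hasDerivAt_iff_tendsto_slope.1 (da 0 ⟨by linarith, hR⟩)).mono_left
      (nhdsWithin_mono 0 (fun x (hx : 0 < x) => hx.ne' : Ioi (0 : ℝ) ⊆ {0}ᶜ))
    refine h.congr fun x => ?_
    rw [slope_def_module, ha0, hw0]
    simp [div_eq_inv_mul]
  have hfin : ‖a' 0‖ ≤ 2 * Real.pi * (2 * M / R + K * R) := by
    refine le_of_tendsto hlim.norm ?_
    filter_upwards [Ioo_mem_nhdsGT (show (0 : ℝ) < R / 2 by linarith)] with ρ hρ
    exact q_le ρ hρ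
  simpa [ha', hfr] using hfin

/-- Interior gradient estimate for a bounded `C²` function with bounded Laplacian. -/
lemma norm_fderiv_le_of_laplacian_bounded (hR : 0 < R)
    (hf : ContDiffOn ℝ 2 f (Metric.ball z₀ R))
    {M K : ℝ} (hM : ∀ z ∈ Metric.ball z₀ R, ‖f z‖ ≤ M)
    (hK : ∀ z ∈ Metric.ball z₀ R, ‖Laplacian.laplacian f z‖ ≤ K) (v : ℂ) :
    ‖fderiv ℝ f z₀ v‖ ≤ 4 * (2 * M / R + K * R) * ‖v‖ := by
  set D := fderiv ℝ f z₀
  have hexp : ∀ θ, D (bdry θ) = Real.cos θ * D 1 + Real.sin θ * D Complex.I := by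
    intro θ
    rw [bdry_eq, map_add, map_ofReal_mul]
    congr 1
    simpa using map_ofReal_mul D (Real.cos θ) 1
  have hpi := Real.pi_pos
  have h1 := norm_integral_weight_mul_fderiv_le hR hf hM hK (w := Real.cos)
    (w' := fun θ => -Real.sin θ) Real.hasDerivAt_cos (fun θ => (Real.hasDerivAt_sin θ).neg)
    Real.abs_cos_le_one (by simp) (by simp)
  have h2 := norm_integral_weight_mul_fderiv_le hR hf hM hK (w := Real.sin)
    (w' := Real.cos) Real.hasDerivAt_sin (fun θ => Real.hasDerivAt_cos θ)
    Real.abs_sin_le_one (by simp) (by simp)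
  -- Orthogonality of cos and sin isolates one partial derivative, with the factor ∫ cos² = π.
  have e1 : ∫ θ in (0 : ℝ)..2 * Real.pi, (Real.cos θ : ℂ) * D (bdry θ) = Real.pi * D 1 := by
    have : ∀ θ, (Real.cos θ : ℂ) * D (bdry θ) =
        ((Real.cos θ ^ 2 : ℝ) : ℂ) * D 1 + ((Real.sin θ * Real.cos θ : ℝ) : ℂ) * D Complex.I := by
      intro θ; rw [hexp]; push_cast; ring
    simp_rw [this]
    rw [intervalIntegral.integral_add, intervalIntegral.integral_mul_const,
      intervalIntegral.integral_mul_const, intervalIntegral.integral_ofReal,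
      intervalIntegral.integral_ofReal, integral_cos_sq, integral_sin_mul_cos₁]
    · simp
    · exact Continuous.intervalIntegrable (by fun_prop) _ _
    · exact Continuous.intervalIntegrable (by fun_prop) _ _
  have e2 : ∫ θ in (0 : ℝ)..2 * Real.pi, (Real.sin θ : ℂ) * D (bdry θ) =
      Real.pi * D Complex.I := by
    have : ∀ θ, (Real.sin θ : ℂ) * D (bdry θ) =
        ((Real.sin θ * Real.cos θ : ℝ) : ℂ) * D 1 + ((Real.sin θ ^ 2 : ℝ) : ℂ) * D Complex.I := by
      intro θ; rw [hexp]; push_cast; ring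
    simp_rw [this]
    rw [intervalIntegral.integral_add, intervalIntegral.integral_mul_const,
      intervalIntegral.integral_mul_const, intervalIntegral.integral_ofReal,
      intervalIntegral.integral_ofReal, integral_sin_sq, integral_sin_mul_cos₁]
    · simp
    · exact Continuous.intervalIntegrable (by fun_prop) _ _
    · exact Continuous.intervalIntegrable (by fun_prop) _ _
  rw [e1, norm_mul, Complex.norm_real, Real.norm_eq_abs, abs_of_pos hpi] at h1
  rw [e2, norm_mul, Complex.norm_real, Real.norm_eq_abs, abs_of_pos hpi] at h2
  have h1' : ‖D 1‖ ≤ 2 * (2 * M / R + K * R) := by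
    refine le_of_mul_le_mul_left ?_ hpi; linarith
  have h2' : ‖D Complex.I‖ ≤ 2 * (2 * M / R + K * R) := by
    refine le_of_mul_le_mul_left ?_ hpi; linarith
  have hv : D v = (v.re : ℂ) * D 1 + (v.im : ℂ) * D Complex.I := by
    rw [← map_ofReal_mul, ← map_ofReal_mul, ← map_add, mul_one, Complex.re_add_im]
  rw [hv]
  calc ‖(v.re : ℂ) * D 1 + (v.im : ℂ) * D Complex.I‖
      ≤ |v.re| * ‖D 1‖ + |v.im| * ‖D Complex.I‖ := by
        refine (norm_add_le _ _).trans (le_of_eq ?_)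
        simp
    _ ≤ ‖v‖ * (2 * (2 * M / R + K * R)) + ‖v‖ * (2 * (2 * M / R + K * R)) := by
        gcongr
        · exact Complex.abs_re_le_norm v
        · exact Complex.abs_im_le_norm v
    _ = _ := by ring

end Gradient

/-! ### The radial equation -/

/-- `a` solves `(sinh · a')' + lam · sinh · a = 0`, with `a'`, `a''` its first two derivatives. -/
structure IsRadialSolution (lam : ℝ) (a a' a'' : ℝ → ℝ) : Prop where
  deriv_fst : ∀ r, HasDerivAt a (a' r) r
  deriv_snd : ∀ r, HasDerivAt a' (a'' r) r
  ode : ∀ r, Real.sinh r * a'' r + Real.cosh r * a' r + lam * Real.sinh r * a r = 0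

namespace IsRadialSolution

variable {lam t : ℝ} {a a' a'' : ℝ → ℝ}

/-- At the singular point r = 0 the equation itself forces regularity, so the value at the origin is
the only initial datum. -/
lemma deriv_zero (h : IsRadialSolution lam a a' a'') : a' 0 = 0 := by
  simpa using h.ode 0

/-- The energy `a'² + lam a²` is nonincreasing, so a solution vanishing at the origin is zero. -/
lemma eq_zero (h : IsRadialSolution lam a a' a'') (hlam : 0 < lam) (h0 : a 0 = 0) {r : ℝ}
    (hr : 0 ≤ r) : a r = 0 ∧ a' r = 0 := by
  have hE : ∀ r, HasDerivAt (fun r => a' r ^ 2 + lam * a r ^ 2)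
      (2 * a' r * a'' r + lam * (2 * a r * a' r)) r := by
    intro r
    refine (((h.deriv_snd r).fun_pow 2).fun_add
      (((h.deriv_fst r).fun_pow 2).const_mul lam)).congr_deriv ?_
    simp
  have hanti : AntitoneOn (fun r => a' r ^ 2 + lam * a r ^ 2) (Ici 0) := by
    refine antitoneOn_of_deriv_nonpos (convex_Ici 0)
      (fun r _ => (hE r).continuousAt.continuousWithinAt)
      (fun r _ => (hE r).differentiableAt.differentiableWithinAt) fun r hr => ?_
    rw [interior_Ici, mem_Ioi] at hr
    rw [(hE r).deriv]
    have hs : 0 < Real.sinh r := Real.sinh_pos_iff.2 hr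
    have hc := Real.cosh_pos r
    have key : Real.sinh r * (2 * a' r * a'' r + lam * (2 * a r * a' r)) =
        -(2 * Real.cosh r * a' r ^ 2) := by
      linear_combination 2 * a' r * h.ode r
    have : 0 ≤ 2 * Real.cosh r * a' r ^ 2 := by positivity
    by_contra! hneg
    nlinarith [mul_pos hs hneg]
  have h1 := hanti (mem_Ici.2 le_rfl) (mem_Ici.2 hr) hr
  simp only [h.deriv_zero, h0] at h1
  have h2 : 0 ≤ lam * a r ^ 2 := by positivity
  have h3 : a r ^ 2 = 0 := by
    by_contra hne
    have : 0 < a r ^ 2 := lt_of_le_of_ne (sq_nonneg _) (Ne.symm hne)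
    have := mul_pos hlam this
    nlinarith [sq_nonneg (a' r)]
  have h4 : a' r ^ 2 = 0 := by nlinarith [sq_nonneg (a' r)]
  exact ⟨by simpa using h3, by simpa using h4⟩

/-- The squared modulus of the outgoing component `e^{-sr} sinh r (a' + s a)`, for
`s = 1/2 + it`. -/
def outgoing (t : ℝ) (a a' : ℝ → ℝ) (r : ℝ) : ℝ :=
  Real.exp (-r) * Real.sinh r ^ 2 * ((a' r + a r / 2) ^ 2 + t ^ 2 * a r ^ 2)

/-- Once the equation eliminates a'', the leading terms cancel. Relative to `outgoing` the
derivative carries the factor e^{-r} / sinh r, which is integrable at infinity; this is what rules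
out decay when t ≠ 0. -/
lemma hasDerivAt_outgoing (h : IsRadialSolution (1 / 4 + t ^ 2) a a' a'') (r : ℝ) :
    HasDerivAt (outgoing t a a') (Real.exp (-r) ^ 2 * Real.sinh r *
      (a r * (a' r + a r / 2) + 2 * t ^ 2 * a r ^ 2)) r := by
  have hexp : HasDerivAt (fun r : ℝ => Real.exp (-r)) (-Real.exp (-r)) r := by
    simpa using (hasDerivAt_neg r).exp
  have hs := (Real.hasDerivAt_sinh r).fun_pow 2
  have hp := (h.deriv_snd r).fun_add ((h.deriv_fst r).div_const 2)
  have hq := (hp.fun_pow 2).fun_add (((h.deriv_fst r).fun_pow 2).const_mul (t ^ 2))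
  refine ((hexp.fun_mul hs).fun_mul hq).congr_deriv ?_
  have he : Real.exp (-r) = Real.cosh r - Real.sinh r := (Real.cosh_sub_sinh r).symm
  have hcs := Real.cosh_sq r
  have hode := h.ode r
  simp only [Nat.cast_ofNat, Nat.add_one_sub_one, pow_one]
  rw [he]
  linear_combination (2 * (Real.cosh r - Real.sinh r) * Real.sinh r * (a' r + a r / 2)) * hode

/-- The factor sinh² kills the value at 0 itself, but a' + a / 2 equals 1/2 there and stays positive
nearby. -/
lemma exists_outgoing_pos (h : IsRadialSolution lam a a' a'') (h0 : a 0 = 1) :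
    ∃ ε > 0, 0 < outgoing t a a' ε := by
  have hc : ContinuousAt (fun r => a' r + a r / 2) 0 :=
    (h.deriv_snd 0).continuousAt.add ((h.deriv_fst 0).continuousAt.div_const 2)
  have hpos : (0 : ℝ) < a' 0 + a 0 / 2 := by rw [h.deriv_zero, h0]; norm_num
  have hev : ∀ᶠ r in 𝓝[>] (0 : ℝ), 0 < a' r + a r / 2 :=
    (hc.eventually (lt_mem_nhds hpos)).filter_mono nhdsWithin_le_nhds
  obtain ⟨ε, hε, hε0⟩ := (hev.and self_mem_nhdsWithin).exists
  refine ⟨ε, hε0, ?_⟩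
  have hs : 0 < Real.sinh ε := Real.sinh_pos_iff.2 hε0
  unfold outgoing
  have := Real.exp_pos (-ε)
  positivity

/-- The outgoing component of the solution regular at the origin does not decay. -/
lemma exists_le_outgoing (h : IsRadialSolution (1 / 4 + t ^ 2) a a' a'') (h0 : a 0 = 1) :
    ∃ δ > 0, ∃ R, ∀ r ≥ R, δ ≤ outgoing t a a' r := by
  obtain ⟨ε, hε, hpos⟩ := h.exists_outgoing_pos (t := t) h0
  rcases eq_or_ne t 0 with rfl | ht
  · refine ⟨_, hpos, ε, fun r hr => ?_⟩
    -- For t = 0 the sign of the derivative of `outgoing` is that of a (a' + a / 2). Multiplied by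
    -- sinh r, this product starts at 0 and is nondecreasing, so `outgoing` is nondecreasing too.
    have hQ : ∀ r, HasDerivAt (fun r => Real.sinh r * (a r * (a' r + a r / 2)))
        (Real.sinh r * (a' r + a r / 2) ^ 2 + Real.exp (-r) * a r ^ 2 / 2) r := by
      intro r
      have hp := (h.deriv_snd r).fun_add ((h.deriv_fst r).div_const 2)
      refine ((Real.hasDerivAt_sinh r).fun_mul ((h.deriv_fst r).fun_mul hp)).congr_deriv ?_
      rw [← Real.cosh_sub_sinh]
      have := h.ode r
      linear_combination a r * this
    have hmono : MonotoneOn (fun r => Real.sinh r * (a r * (a' r + a r / 2))) (Ici 0) := by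
      refine monotoneOn_of_deriv_nonneg (convex_Ici 0)
        (fun r _ => (hQ r).continuousAt.continuousWithinAt)
        (fun r _ => (hQ r).differentiableAt.differentiableWithinAt) fun r hr => ?_
      rw [interior_Ici, mem_Ioi] at hr
      rw [(hQ r).deriv]
      have hs : 0 < Real.sinh r := Real.sinh_pos_iff.2 hr
      have := Real.exp_pos (-r)
      positivity
    have hN : MonotoneOn (outgoing 0 a a') (Ici 0) := by
      refine monotoneOn_of_deriv_nonneg (convex_Ici 0)
        (fun r _ => (h.hasDerivAt_outgoing r).continuousAt.continuousWithinAt)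
        (fun r _ => (h.hasDerivAt_outgoing r).differentiableAt.differentiableWithinAt)
        fun r hr => ?_
      rw [interior_Ici, mem_Ioi] at hr
      rw [(h.hasDerivAt_outgoing r).deriv]
      have := hmono (mem_Ici.2 le_rfl) (mem_Ici.2 hr.le) hr.le
      simp only [Real.sinh_zero, zero_mul] at this
      have h2 : 0 ≤ Real.exp (-r) ^ 2 * (Real.sinh r * (a r * (a' r + a r / 2))) := by positivity
      calc (0 : ℝ) ≤ _ := h2
        _ = _ := by ring
    exact hN (mem_Ici.2 hε.le) (mem_Ici.2 (hε.le.trans hr)) hr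
  · have hd : 0 < 1 - Real.exp (-ε) ^ 2 := by
      have h1 : Real.exp (-ε) < 1 := by simpa using hε
      nlinarith [Real.exp_pos (-ε)]
    -- For t ≠ 0 the derivative of `outgoing` is at least -e^{-r} / (2 |t| sinh r) times `outgoing`.
    -- This κ is chosen so that on r ≥ ε the logarithmic derivative 2 κ e^{-2r} of the integrating
    -- factor exp(-κ e^{-2r}) compensates that loss.
    set κ : ℝ := 1 / (2 * |t| * (1 - Real.exp (-ε) ^ 2)) with hκ
    have htp : 0 < |t| := abs_pos.2 ht
    have hκp : 0 < κ := by positivity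
    have hexp : ∀ r : ℝ, HasDerivAt (fun r : ℝ => Real.exp (-κ * Real.exp (-r) ^ 2))
        (Real.exp (-κ * Real.exp (-r) ^ 2) * (2 * κ * Real.exp (-r) ^ 2)) r := by
      intro r
      have h1 : HasDerivAt (fun r : ℝ => Real.exp (-r)) (-Real.exp (-r)) r := by
        simpa using (hasDerivAt_neg r).exp
      refine ((h1.fun_pow 2).const_mul (-κ)).exp.congr_deriv ?_
      simp only [Nat.cast_ofNat, Nat.add_one_sub_one, pow_one]
      ring
    have hM := fun r => (h.hasDerivAt_outgoing r).fun_mul (hexp r)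
    have hmono : MonotoneOn (fun r => outgoing t a a' r * Real.exp (-κ * Real.exp (-r) ^ 2))
        (Ici ε) := by
      refine monotoneOn_of_deriv_nonneg (convex_Ici ε)
        (fun r _ => (hM r).continuousAt.continuousWithinAt)
        (fun r _ => (hM r).differentiableAt.differentiableWithinAt) fun r hr => ?_
      rw [interior_Ici, mem_Ioi] at hr
      rw [(hM r).deriv]
      have hr0 : 0 < r := hε.trans hr
      have hs : 0 < Real.sinh r := Real.sinh_pos_iff.2 hr0
      have he := Real.exp_pos (-r)
      have hE := Real.exp_pos (-κ * Real.exp (-r) ^ 2)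
      set p := a' r + a r / 2 with hp
      set x := a r
      set q := p ^ 2 + t ^ 2 * x ^ 2 with hq
      have hq0 : 0 ≤ q := by positivity
      -- Completion of the square (p + |t| x)². This is where t ≠ 0 is essential.
      have hxp : -(q / (2 * |t|)) ≤ x * p := by
        rw [neg_le, ← sub_nonneg]
        have : q / (2 * |t|) - -(x * p) = (p + |t| * x) ^ 2 / (2 * |t|) := by
          rw [hq, ← sq_abs t]; field_simp; ring
        rw [this]; positivity
      -- `1 ≤ 2 sinh r e^{-r} / (1 - e^{-2ε})`
      have hse : 1 - Real.exp (-ε) ^ 2 ≤ 2 * Real.sinh r * Real.exp (-r) := by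
        have h1 : 2 * Real.sinh r * Real.exp (-r) = 1 - Real.exp (-r) ^ 2 := by
          rw [Real.sinh_eq, Real.exp_neg]
          have := (Real.exp_pos r).ne'
          field_simp
        rw [h1]
        have : Real.exp (-r) ≤ Real.exp (-ε) := Real.exp_le_exp.2 (by linarith)
        gcongr
      have hkey : 1 / (2 * |t|) ≤ 2 * κ * Real.exp (-r) * Real.sinh r := by
        have : 2 * κ * Real.exp (-r) * Real.sinh r =
            (2 * Real.sinh r * Real.exp (-r)) / (2 * |t| * (1 - Real.exp (-ε) ^ 2)) := by
          rw [hκ]; ring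
        rw [this, div_le_div_iff₀ (by positivity) (by positivity), one_mul]
        calc 2 * |t| * (1 - Real.exp (-ε) ^ 2) ≤ 2 * |t| * (2 * Real.sinh r * Real.exp (-r)) := by
              gcongr
          _ = _ := by ring
      have hfin : 0 ≤ x * p + 2 * t ^ 2 * x ^ 2 + 2 * κ * Real.exp (-r) * Real.sinh r * q := by
        have h1 : 0 ≤ 2 * t ^ 2 * x ^ 2 := by positivity
        have h2 : 1 / (2 * |t|) * q ≤ 2 * κ * Real.exp (-r) * Real.sinh r * q := by gcongr
        have h3 : 1 / (2 * |t|) * q = q / (2 * |t|) := by ring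
        linarith
      have : 0 ≤ Real.exp (-κ * Real.exp (-r) ^ 2) * (Real.exp (-r) ^ 2 * Real.sinh r *
          (x * p + 2 * t ^ 2 * x ^ 2 + 2 * κ * Real.exp (-r) * Real.sinh r * q)) := by positivity
      calc (0 : ℝ) ≤ _ := this
        _ = _ := by
          simp only [outgoing]
          rw [← hp, ← hq]
          ring
    refine ⟨outgoing t a a' ε * Real.exp (-κ * Real.exp (-ε) ^ 2), by positivity, ε,
      fun r hr => ?_⟩
    refine (hmono (mem_Ici.2 le_rfl) (mem_Ici.2 hr) hr).trans ?_
    have hnn : 0 ≤ outgoing t a a' r := by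
      unfold outgoing
      have := Real.exp_pos (-r)
      positivity
    have hle : Real.exp (-κ * Real.exp (-r) ^ 2) ≤ 1 := by
      rw [Real.exp_le_one_iff]
      have : 0 ≤ κ * Real.exp (-r) ^ 2 := by positivity
      linarith
    exact mul_le_of_le_one_right hnn hle

end IsRadialSolution

/-! ### Hyperbolic polar coordinates -/

lemma tanh_half_mem (r : ℝ) : Real.tanh (r / 2) ∈ Ioo (-1 : ℝ) 1 :=
  ⟨Real.neg_one_lt_tanh _, Real.tanh_lt_one _⟩

lemma one_sub_tanh_half_sq_pos (r : ℝ) : 0 < 1 - Real.tanh (r / 2) ^ 2 := by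
  have h := tanh_half_mem r
  nlinarith [h.1, h.2]

lemma hasDerivAt_tanh_half (r : ℝ) :
    HasDerivAt (fun r => Real.tanh (r / 2)) ((1 - Real.tanh (r / 2) ^ 2) / 2) r := by
  have hc := (Real.cosh_pos (r / 2)).ne'
  have h : HasDerivAt (fun r : ℝ => Real.sinh (r / 2) / Real.cosh (r / 2)) _ r :=
    ((hasDerivAt_id r).div_const 2).sinh.fun_div ((hasDerivAt_id r).div_const 2).cosh hc
  simp only [← Real.tanh_eq_sinh_div_cosh, id] at h
  refine h.congr_deriv ?_
  rw [Real.tanh_eq_sinh_div_cosh]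
  field_simp

lemma hasDerivAt_one_sub_tanh_half_sq (r : ℝ) :
    HasDerivAt (fun r => (1 - Real.tanh (r / 2) ^ 2) / 2)
      (-(Real.tanh (r / 2) * (1 - Real.tanh (r / 2) ^ 2) / 2)) r := by
  refine ((((hasDerivAt_tanh_half r).fun_pow 2).const_sub 1).div_const 2).congr_deriv ?_
  simp only [Nat.cast_ofNat, Nat.add_one_sub_one, pow_one]
  ring

lemma continuous_tanh_half : Continuous fun r : ℝ => Real.tanh (r / 2) :=
  continuous_iff_continuousAt.2 fun r => (hasDerivAt_tanh_half r).continuousAt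

lemma sinh_eq_tanh_half (r : ℝ) :
    Real.sinh r = 2 * Real.tanh (r / 2) / (1 - Real.tanh (r / 2) ^ 2) := by
  rw [eq_div_iff (one_sub_tanh_half_sq_pos r).ne', Real.tanh_eq_sinh_div_cosh]
  have hc := (Real.cosh_pos (r / 2)).ne'
  have h2 : Real.sinh r = 2 * Real.sinh (r / 2) * Real.cosh (r / 2) := by
    rw [← Real.sinh_two_mul]; ring_nf
  have h3 := Real.cosh_sq (r / 2)
  rw [h2]
  field_simp
  rw [h3]; ring

lemma cosh_eq_tanh_half (r : ℝ) :
    Real.cosh r = (1 + Real.tanh (r / 2) ^ 2) / (1 - Real.tanh (r / 2) ^ 2) := by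
  rw [eq_div_iff (one_sub_tanh_half_sq_pos r).ne', Real.tanh_eq_sinh_div_cosh]
  have hc := (Real.cosh_pos (r / 2)).ne'
  have h2 : Real.cosh r = Real.cosh (r / 2) ^ 2 + Real.sinh (r / 2) ^ 2 := by
    rw [← Real.cosh_two_mul]; ring_nf
  have h3 := Real.cosh_sq (r / 2)
  rw [h2]
  field_simp
  rw [h3]; ring

/-- The summand 0 is the centre z₀ in the ray and circle lemmas above. -/
lemma polar_eq (r θ : ℝ) : polar r θ = 0 + (Real.tanh (r / 2) : ℂ) * bdry θ := by
  simp [polar]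

lemma norm_polar (r θ : ℝ) : ‖polar r θ‖ = |Real.tanh (r / 2)| := by
  simp only [polar, norm_mul, norm_bdry, mul_one, Complex.norm_real, Real.norm_eq_abs]

lemma polar_mem (r θ : ℝ) : polar r θ ∈ Metric.ball (0 : ℂ) 1 := by
  rw [polar_eq]
  exact polar_mem_ball (tanh_half_mem r) θ

lemma continuous_polar : Continuous fun p : ℝ × ℝ => polar p.1 p.2 := by
  unfold polar
  have := continuous_tanh_half.comp (continuous_fst (X := ℝ) (Y := ℝ))
  exact (Complex.continuous_ofReal.comp this).mul (continuous_bdry.comp continuous_snd)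

lemma continuous_comp_polar {E : Type*} [TopologicalSpace E] {g : ℂ → E}
    (hg : ContinuousOn g (Metric.ball 0 1)) : Continuous fun p : ℝ × ℝ => g (polar p.1 p.2) :=
  hg.comp_continuous continuous_polar fun p => polar_mem p.1 p.2

/-! ### Derivatives in hyperbolic polar coordinates -/

/-- `∂f/∂r` in hyperbolic polar coordinates. -/
def radialDeriv (f : ℂ → ℂ) (r θ : ℝ) : ℂ :=
  (((1 - Real.tanh (r / 2) ^ 2) / 2 : ℝ) : ℂ) * fderiv ℝ f (polar r θ) (bdry θ)

/-- `∂²f/∂r²` in hyperbolic polar coordinates. -/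
def radialSecond (f : ℂ → ℂ) (r θ : ℝ) : ℂ :=
  ((-(Real.tanh (r / 2) * (1 - Real.tanh (r / 2) ^ 2) / 2) : ℝ) : ℂ) *
      fderiv ℝ f (polar r θ) (bdry θ) +
    (((1 - Real.tanh (r / 2) ^ 2) / 2 : ℝ) : ℂ) ^ 2 *
      fderiv ℝ (fderiv ℝ f) (polar r θ) (bdry θ) (bdry θ)

/-- `∂f/∂θ` in hyperbolic polar coordinates. -/
def angularDeriv (f : ℂ → ℂ) (r θ : ℝ) : ℂ :=
  (Real.tanh (r / 2) : ℂ) * fderiv ℝ f (polar r θ) (Complex.I * bdry θ)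

section Derivatives

variable {f : ℂ → ℂ}

lemma hasDerivAt_radial (hf : ContDiffOn ℝ 2 f (Metric.ball 0 1)) (r θ : ℝ) :
    HasDerivAt (fun r => f (polar r θ)) (radialDeriv f r θ) r := by
  have := hasDerivAt_ray Metric.isOpen_ball hf (hasDerivAt_tanh_half r) (z₀ := 0) (e := bdry θ)
    (polar_mem_ball (tanh_half_mem r) θ)
  simp only [← polar_eq] at this
  exact this

lemma normalDeriv_eq (hf : ContDiffOn ℝ 2 f (Metric.ball 0 1)) (r θ : ℝ) :
    normalDeriv f r θ = radialDeriv f r θ :=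
  (hasDerivAt_radial hf r θ).deriv

lemma hasDerivAt_radialDeriv (hf : ContDiffOn ℝ 2 f (Metric.ball 0 1)) (r θ : ℝ) :
    HasDerivAt (fun r => radialDeriv f r θ) (radialSecond f r θ) r := by
  have h := hasDerivAt_fderiv_ray Metric.isOpen_ball hf (hasDerivAt_tanh_half r) (z₀ := 0)
    (e := bdry θ) (polar_mem_ball (tanh_half_mem r) θ)
  simp only [← polar_eq] at h
  refine ((hasDerivAt_one_sub_tanh_half_sq r).ofReal_comp.fun_mul h).congr_deriv ?_
  rw [radialSecond]
  ring

lemma hasDerivAt_angularDeriv (hf : ContDiffOn ℝ 2 f (Metric.ball 0 1)) (r θ : ℝ) :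
    HasDerivAt (fun θ => angularDeriv f r θ) (angularSecond f 0 (Real.tanh (r / 2)) θ) θ := by
  have := hasDerivAt_fderiv_circle Metric.isOpen_ball hf (z₀ := 0)
    (polar_mem_ball (tanh_half_mem r) θ)
  simp only [← polar_eq] at this
  exact this

lemma continuous_radialDeriv (hf : ContDiffOn ℝ 2 f (Metric.ball 0 1)) :
    Continuous (Function.uncurry (radialDeriv f)) := by
  have h1 := continuous_comp_polar (contDiffOn_fderiv Metric.isOpen_ball hf).continuousOn
  have ht := continuous_tanh_half.comp (continuous_fst (X := ℝ) (Y := ℝ))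
  have hb : Continuous fun p : ℝ × ℝ => bdry p.2 := by fun_prop
  exact (Complex.continuous_ofReal.comp ((continuous_const.sub (ht.pow 2)).div_const 2)).mul
    (h1.clm_apply hb)

lemma continuous_radialSecond (hf : ContDiffOn ℝ 2 f (Metric.ball 0 1)) :
    Continuous (Function.uncurry (radialSecond f)) := by
  have h1 := continuous_comp_polar (contDiffOn_fderiv Metric.isOpen_ball hf).continuousOn
  have h2 := continuous_comp_polar (continuousOn_fderiv_fderiv Metric.isOpen_ball hf)
  have ht := continuous_tanh_half.comp (continuous_fst (X := ℝ) (Y := ℝ))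
  have hb : Continuous fun p : ℝ × ℝ => bdry p.2 := by fun_prop
  exact ((Complex.continuous_ofReal.comp
    ((ht.mul (continuous_const.sub (ht.pow 2))).div_const 2).neg).mul (h1.clm_apply hb)).add
    (((Complex.continuous_ofReal.comp ((continuous_const.sub (ht.pow 2)).div_const 2)).pow 2).mul
    ((h2.clm_apply hb).clm_apply hb))

lemma continuous_angularSecond (hf : ContDiffOn ℝ 2 f (Metric.ball 0 1)) :
    Continuous fun p : ℝ × ℝ => angularSecond f 0 (Real.tanh (p.1 / 2)) p.2 := by
  have h1 := continuous_comp_polar (contDiffOn_fderiv Metric.isOpen_ball hf).continuousOn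
  have h2 := continuous_comp_polar (continuousOn_fderiv_fderiv Metric.isOpen_ball hf)
  have ht := Complex.continuous_ofReal.comp
    (continuous_tanh_half.comp (continuous_fst (X := ℝ) (Y := ℝ)))
  have hb : Continuous fun p : ℝ × ℝ => bdry p.2 := by fun_prop
  have hib : Continuous fun p : ℝ × ℝ => Complex.I * bdry p.2 := by fun_prop
  simp only [angularSecond, ← polar_eq]
  exact ((ht.pow 2).mul ((h2.clm_apply hib).clm_apply hib)).sub (ht.mul (h1.clm_apply hb))

end Derivatives

section Eigen

variable {s : ℂ} {f : ℂ → ℂ}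

/-- The eigenfunction equation in hyperbolic polar coordinates. -/
lemma IsBoundedEigenfunction.polar_equation (hf : IsBoundedEigenfunction s f) (r θ : ℝ) :
    (Real.sinh r : ℂ) ^ 2 * radialSecond f r θ +
      (Real.sinh r : ℂ) * (Real.cosh r : ℂ) * radialDeriv f r θ +
      angularSecond f 0 (Real.tanh (r / 2)) θ =
      -(s * (1 - s)) * (Real.sinh r : ℂ) ^ 2 * f (polar r θ) := by
  have he := hf.eigen _ (polar_mem r θ)
  rw [hypLaplacian, norm_polar, sq_abs, ← second_fderiv_rotated_frame f _ θ] at he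
  rw [sinh_eq_tanh_half, cosh_eq_tanh_half, radialSecond, radialDeriv, angularSecond, ← polar_eq]
  have hq : (1 - (Real.tanh (r / 2) : ℂ) ^ 2) ≠ 0 := by
    exact_mod_cast (one_sub_tanh_half_sq_pos r).ne'
  -- All coefficients are now rational in T = tanh (r / 2), so the identity is purely algebraic.
  generalize Real.tanh (r / 2) = T at *
  push_cast at he ⊢
  field_simp
  linear_combination 4 * (T : ℂ) ^ 2 * he

end Eigen

/-! ### The density and its primitive -/

section Density

variable {s : ℂ} {f : ℂ → ℂ}

lemma continuous_angularSecond_right (hf : ContDiffOn ℝ 2 f (Metric.ball 0 1)) (r : ℝ) :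
    Continuous fun θ => angularSecond f 0 (Real.tanh (r / 2)) θ := by
  have h : Continuous (Function.uncurry fun r θ => angularSecond f 0 (Real.tanh (r / 2)) θ) :=
    continuous_angularSecond hf
  exact h.uncurry_left r

lemma continuous_comp_polar_right (hf : ContinuousOn f (Metric.ball 0 1)) (r : ℝ) :
    Continuous fun θ => f (polar r θ) := by
  have h : Continuous (Function.uncurry fun r θ => f (polar r θ)) := continuous_comp_polar hf
  exact h.uncurry_left r

lemma density_eq (hf : ContDiffOn ℝ 2 f (Metric.ball 0 1)) (r θ : ℝ) :
    density s f r θ = Complex.exp (-s * r) * (radialDeriv f r θ + s * f (polar r θ)) *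
      (Real.sinh r : ℂ) := by
  rw [density, normalDeriv_eq hf]

lemma continuous_density (hf : ContDiffOn ℝ 2 f (Metric.ball 0 1)) :
    Continuous (Function.uncurry (density s f)) := by
  have h1 := continuous_radialDeriv hf
  have h0 := continuous_comp_polar hf.continuousOn
  have : Function.uncurry (density s f) = fun p : ℝ × ℝ => Complex.exp (-s * p.1) *
      (Function.uncurry (radialDeriv f) p + s * f (polar p.1 p.2)) * (Real.sinh p.1 : ℂ) := by
    ext p
    exact density_eq hf p.1 p.2
  rw [this]
  have hs : Continuous fun p : ℝ × ℝ => (Real.sinh p.1 : ℂ) :=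
    Complex.continuous_ofReal.comp (Real.continuous_sinh.comp continuous_fst)
  have he : Continuous fun p : ℝ × ℝ => Complex.exp (-s * p.1) := by fun_prop
  exact (he.mul (h1.add (continuous_const.mul h0))).mul hs

lemma continuous_density_right (hf : ContDiffOn ℝ 2 f (Metric.ball 0 1)) (r : ℝ) :
    Continuous (density s f r) :=
  (continuous_density hf).uncurry_left r

/-- The radial derivative of the density. -/
def densityDeriv (s : ℂ) (f : ℂ → ℂ) (r θ : ℝ) : ℂ :=
  Complex.exp (-s * r) * (s * (Real.exp (-r) : ℂ) * f (polar r θ) -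
    angularSecond f 0 (Real.tanh (r / 2)) θ / (Real.sinh r : ℂ))

lemma hasDerivAt_cexp_neg_mul (s : ℂ) (r : ℝ) :
    HasDerivAt (fun r : ℝ => Complex.exp (-s * r)) (-s * Complex.exp (-s * r)) r := by
  have hid : HasDerivAt (fun r : ℝ => (r : ℂ)) 1 r := Complex.ofRealCLM.hasDerivAt
  refine ((hid.const_mul (-s)).cexp).congr_deriv ?_
  ring

/-- The choice of exponent s in front and of the combination ∂_r f + s f makes every term of size
sinh r times f or its radial derivatives cancel. The surviving multiple of f is s (cosh r - sinh r)
= s e^{-r}. -/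
lemma hasDerivAt_density (hf : IsBoundedEigenfunction s f) {r : ℝ} (hr : 0 < r) (θ : ℝ) :
    HasDerivAt (fun r => density s f r θ) (densityDeriv s f r θ) r := by
  have h1 := hasDerivAt_radialDeriv hf.contDiffOn r θ
  have h0 := hasDerivAt_radial hf.contDiffOn r θ
  have hs := (Real.hasDerivAt_sinh r).ofReal_comp
  have := ((hasDerivAt_cexp_neg_mul s r).fun_mul (h1.fun_add (h0.const_mul s))).fun_mul hs
  simp only [← density_eq hf.contDiffOn] at this
  refine this.congr_deriv ?_
  have hne : (Real.sinh r : ℂ) ≠ 0 := by exact_mod_cast (Real.sinh_pos_iff.2 hr).ne'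
  have he : (Real.exp (-r) : ℂ) = (Real.cosh r : ℂ) - (Real.sinh r : ℂ) := by
    rw [← Complex.ofReal_sub, Real.cosh_sub_sinh]
  have hpde := hf.polar_equation r θ
  rw [densityDeriv, he]
  field_simp
  linear_combination hpde

lemma continuousOn_densityDeriv (hf : ContDiffOn ℝ 2 f (Metric.ball 0 1)) :
    ContinuousOn (Function.uncurry (densityDeriv s f)) (Ioi 0 ×ˢ univ) := by
  have h0 := continuous_comp_polar hf.continuousOn
  have h2 := continuous_angularSecond hf
  have hs : Continuous fun p : ℝ × ℝ => (Real.sinh p.1 : ℂ) :=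
    Complex.continuous_ofReal.comp (Real.continuous_sinh.comp continuous_fst)
  have he : Continuous fun p : ℝ × ℝ => Complex.exp (-s * p.1) := by fun_prop
  have he' : Continuous fun p : ℝ × ℝ => s * (Real.exp (-p.1) : ℂ) := by fun_prop
  refine he.continuousOn.mul ((he'.mul h0).continuousOn.sub
    (h2.continuousOn.div hs.continuousOn ?_))
  rintro ⟨r, θ⟩ ⟨hr, -⟩
  exact_mod_cast (Real.sinh_pos_iff.2 hr).ne'

/-- `∫_0^α` of the density at radius `r`. -/
def densityPrimitive (s : ℂ) (f : ℂ → ℂ) (r α : ℝ) : ℂ := ∫ θ in (0 : ℝ)..α, density s f r θ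

/-- Integration in θ is the gain over the pointwise density: ∂_θ² f becomes a difference of values
of ∂_θ f, so first-order estimates on f suffice. -/
lemma hasDerivAt_densityPrimitive (hf : IsBoundedEigenfunction s f) {r : ℝ} (hr : 0 < r) (α : ℝ) :
    HasDerivAt (fun r => densityPrimitive s f r α)
      (Complex.exp (-s * r) * (s * (Real.exp (-r) : ℂ) * (∫ θ in (0 : ℝ)..α, f (polar r θ)) -
        (angularDeriv f r α - angularDeriv f r 0) / (Real.sinh r : ℂ))) r := by
  have h := hasDerivAt_integral_of_continuousOn (F := density s f) (F' := densityDeriv s f)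
    isOpen_Ioi 0 α (continuous_density hf.contDiffOn).continuousOn
    (continuousOn_densityDeriv hf.contDiffOn) (fun r hr θ => hasDerivAt_density hf hr θ) hr
  have h2 := continuous_angularSecond_right hf.contDiffOn r
  have h0 := continuous_comp_polar_right hf.contDiffOn.continuousOn r
  have hftc := intervalIntegral.integral_eq_sub_of_hasDerivAt (a := 0) (b := α)
    (fun θ _ => hasDerivAt_angularDeriv hf.contDiffOn r θ) (h2.intervalIntegrable _ _)
  have key : ∫ θ in (0 : ℝ)..α, densityDeriv s f r θ = Complex.exp (-s * r) *
      (s * (Real.exp (-r) : ℂ) * (∫ θ in (0 : ℝ)..α, f (polar r θ)) -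
        (angularDeriv f r α - angularDeriv f r 0) / (Real.sinh r : ℂ)) := by
    simp only [densityDeriv]
    rw [intervalIntegral.integral_const_mul, intervalIntegral.integral_sub,
      intervalIntegral.integral_const_mul, intervalIntegral.integral_div, hftc]
    · exact (continuous_const.mul h0).intervalIntegrable _ _
    · exact (h2.div_const _).intervalIntegrable _ _
  rw [← key]
  exact h

/-! ### Bounds -/

lemma norm_cexp_neg_mul (hs : s.re = 1 / 2) (r : ℝ) :
    ‖Complex.exp (-s * r)‖ = Real.exp (-r / 2) := by
  rw [Complex.norm_exp]
  congr 1
  simp [hs]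
  ring

/-- The Euclidean gradient of a bounded eigenfunction is `O(1 / (1 - |z|))`. -/
lemma IsBoundedEigenfunction.exists_norm_fderiv_le (hf : IsBoundedEigenfunction s f) :
    ∃ C : ℝ, 0 ≤ C ∧ ∀ z ∈ Metric.ball (0 : ℂ) 1, ∀ v : ℂ,
      ‖fderiv ℝ f z v‖ ≤ C / (1 - ‖z‖) * ‖v‖ := by
  obtain ⟨M, hM⟩ := hf.bounded
  have hM0 : 0 ≤ M := (norm_nonneg _).trans (hM 0 (Metric.mem_ball_self one_pos))
  set L : ℝ := ‖s * (1 - s)‖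
  have hL : 0 ≤ L := norm_nonneg _
  refine ⟨4 * (4 * M + 2 * (4 * L * M)), by positivity, fun z hz v => ?_⟩
  have hz1 : ‖z‖ < 1 := by simpa using hz
  -- On the disc of radius R about z one has 1 - |w|² ≥ R. The eigenvalue equation then bounds the
  -- Laplacian by O(R⁻²), and the interior estimate gives O(R⁻¹) for the gradient.
  set R : ℝ := (1 - ‖z‖) / 2 with hR
  have hRp : 0 < R := by rw [hR]; linarith
  have hsub : ∀ w ∈ Metric.ball z R, R ≤ 1 - ‖w‖ := by
    intro w hw
    have h1 : ‖w - z‖ < R := by simpa [dist_eq_norm] using hw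
    have h2 : ‖w‖ ≤ ‖z‖ + ‖w - z‖ := by simpa using norm_add_le z (w - z)
    linarith
  have hball : Metric.ball z R ⊆ Metric.ball 0 1 := by
    intro w hw
    have := hsub w hw
    simp only [Metric.mem_ball, dist_zero_right]
    linarith
  have hlap : ∀ w ∈ Metric.ball z R, ‖Laplacian.laplacian f w‖ ≤ 4 * L * M / R ^ 2 := by
    intro w hw
    have he := congrArg norm (hf.eigen w (hball hw))
    rw [hypLaplacian, norm_mul, norm_mul, norm_neg, Complex.norm_real, Real.norm_eq_abs,
      abs_of_nonneg (by positivity)] at he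
    have hw1 := hsub w hw
    have hq : R ≤ 1 - ‖w‖ ^ 2 := by nlinarith [norm_nonneg w]
    rw [le_div_iff₀ (by positivity)]
    calc ‖Laplacian.laplacian f w‖ * R ^ 2
        ≤ ‖Laplacian.laplacian f w‖ * (1 - ‖w‖ ^ 2) ^ 2 := by gcongr
      _ = 4 * (L * ‖f w‖) := by rw [← he]; ring
      _ ≤ 4 * (L * M) := by gcongr; exact hM w (hball hw)
      _ = _ := by ring
  refine (norm_fderiv_le_of_laplacian_bounded hRp (hf.contDiffOn.mono hball)
    (fun w hw => hM w (hball hw)) hlap v).trans (le_of_eq ?_)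
  have : 1 - ‖z‖ = 2 * R := by rw [hR]; ring
  rw [this]
  field_simp
  ring

/-- The Euclidean gradient may grow like 1 / (1 - T) with T = tanh (r / 2). The factor (1 - T²) / 2
in ∂_r absorbs this growth, while for ∂_θ it is comparable to sinh r. -/
lemma IsBoundedEigenfunction.exists_derivative_bounds (hf : IsBoundedEigenfunction s f) :
    ∃ C : ℝ, 0 ≤ C ∧ ∀ r θ : ℝ, 0 ≤ r → ‖f (polar r θ)‖ ≤ C ∧ ‖radialDeriv f r θ‖ ≤ C ∧
      ‖angularDeriv f r θ‖ ≤ C * Real.sinh r := by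
  obtain ⟨M, hM⟩ := hf.bounded
  obtain ⟨C, hC, hgrad⟩ := hf.exists_norm_fderiv_le
  have hM0 : 0 ≤ M := (norm_nonneg _).trans (hM 0 (Metric.mem_ball_self one_pos))
  refine ⟨M + C, by positivity, fun r θ hr => ?_⟩
  have hT := tanh_half_mem r
  have hT0 : 0 ≤ Real.tanh (r / 2) := by
    rw [Real.tanh_eq_sinh_div_cosh]
    exact div_nonneg (Real.sinh_nonneg_iff.2 (by positivity)) (Real.cosh_pos _).le
  have hq := one_sub_tanh_half_sq_pos r
  have hg : ∀ v : ℂ, ‖fderiv ℝ f (polar r θ) v‖ ≤ C / (1 - Real.tanh (r / 2)) * ‖v‖ := by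
    intro v
    have := hgrad _ (polar_mem r θ) v
    rwa [norm_polar, abs_of_nonneg hT0] at this
  refine ⟨(hM _ (polar_mem r θ)).trans (by linarith), ?_, ?_⟩
  · have h1 := hg (bdry θ)
    rw [norm_bdry, mul_one] at h1
    rw [radialDeriv, norm_mul, Complex.norm_real, Real.norm_eq_abs, abs_of_pos (by positivity)]
    generalize Real.tanh (r / 2) = T at *
    have h1T : 0 < 1 - T := by linarith [hT.2]
    calc (1 - T ^ 2) / 2 * _ ≤ (1 - T ^ 2) / 2 * (C / (1 - T)) := by gcongr
      _ = C * ((1 + T) / 2) := by field_simp; ring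
      _ ≤ C * 1 := by gcongr; linarith [hT.2]
      _ ≤ M + C := by linarith
  · have h1 := hg (Complex.I * bdry θ)
    rw [norm_mul, norm_bdry, Complex.norm_I, mul_one, mul_one] at h1
    rw [angularDeriv, norm_mul, Complex.norm_real, Real.norm_eq_abs, abs_of_nonneg hT0,
      sinh_eq_tanh_half]
    generalize Real.tanh (r / 2) = T at *
    have h1T : 0 < 1 - T := by linarith [hT.2]
    calc T * _ ≤ T * (C / (1 - T)) := by gcongr
      _ = C * (T * (1 + T) / (1 - T ^ 2)) := by
        have : 1 - T ^ 2 = (1 - T) * (1 + T) := by ring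
        have h2 : 1 + T ≠ 0 := by linarith [hT.1]
        rw [this]; field_simp
      _ ≤ C * (2 * T / (1 - T ^ 2)) := by
        gcongr ?_ * (?_ / _)
        nlinarith [hT.2]
      _ ≤ (M + C) * (2 * T / (1 - T ^ 2)) := by gcongr; linarith

/-- The radial derivative of the primitive is O(e^{-r/2}), hence integrable up to infinity, and the
bound is uniform in r'. All real α are allowed, at the price of a factor 1 + |α|, because arcs will
be parametrized by intervals that need not lie in [0, 2π]. -/
lemma IsBoundedEigenfunction.exists_density_bounds (hs : s.re = 1 / 2)
    (hf : IsBoundedEigenfunction s f) :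
    ∃ K : ℝ, 0 ≤ K ∧ (∀ r θ : ℝ, 0 ≤ r → ‖density s f r θ‖ ≤ K * Real.exp (r / 2)) ∧
      ∀ r r' α : ℝ, 0 < r → r ≤ r' →
        ‖densityPrimitive s f r' α - densityPrimitive s f r α‖ ≤
          K * (1 + |α|) * Real.exp (-r / 2) := by
  obtain ⟨C, hC, hb⟩ := hf.exists_derivative_bounds
  set m := ‖s‖
  have hm : 0 ≤ m := norm_nonneg s
  refine ⟨4 * C * (1 + m), by positivity, fun r θ hr => ?_, fun r r' α hr hrr' => ?_⟩
  · obtain ⟨h0, h1, -⟩ := hb r θ hr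
    rw [density_eq hf.contDiffOn, norm_mul, norm_mul, norm_cexp_neg_mul hs, Complex.norm_real,
      Real.norm_eq_abs, abs_of_nonneg (Real.sinh_nonneg_iff.2 hr)]
    have hsum : ‖radialDeriv f r θ + s * f (polar r θ)‖ ≤ C + m * C := by
      refine (norm_add_le _ _).trans ?_
      rw [norm_mul]
      gcongr
    have hsinh : Real.sinh r ≤ Real.exp r := by
      rw [Real.sinh_eq]; linarith [Real.exp_pos r, Real.exp_pos (-r)]
    calc Real.exp (-r / 2) * ‖radialDeriv f r θ + s * f (polar r θ)‖ * Real.sinh r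
        ≤ Real.exp (-r / 2) * (C + m * C) * Real.exp r := by
          gcongr
      _ = C * (1 + m) * (Real.exp (-r / 2) * Real.exp r) := by ring
      _ = C * (1 + m) * Real.exp (r / 2) := by rw [← Real.exp_add]; ring_nf
      _ ≤ 4 * C * (1 + m) * Real.exp (r / 2) := by
          gcongr; linarith
  · set D : ℝ → ℂ := fun r => Complex.exp (-s * r) * (s * (Real.exp (-r) : ℂ) *
      (∫ θ in (0 : ℝ)..α, f (polar r θ)) -
        (angularDeriv f r α - angularDeriv f r 0) / (Real.sinh r : ℂ)) with hD
    have hDle : ∀ x : ℝ, 0 < x → ‖D x‖ ≤ 2 * C * (1 + m) * (1 + |α|) * Real.exp (-x / 2) := by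
      intro x hx
      have hsx : 0 < Real.sinh x := Real.sinh_pos_iff.2 hx
      have hI : ‖∫ θ in (0 : ℝ)..α, f (polar x θ)‖ ≤ C * |α| := by
        simpa using intervalIntegral.norm_integral_le_of_norm_le_const
          (a := 0) (b := α) (f := fun θ => f (polar x θ)) (fun θ _ => (hb x θ hx.le).1)
      have hA : ‖(angularDeriv f x α - angularDeriv f x 0) / (Real.sinh x : ℂ)‖ ≤ 2 * C := by
        rw [norm_div, Complex.norm_real, Real.norm_eq_abs, abs_of_pos hsx, div_le_iff₀ hsx]
        refine (norm_sub_le _ _).trans ?_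
        linarith [(hb x α hx.le).2.2, (hb x 0 hx.le).2.2]
      have hex : Real.exp (-x) ≤ 1 := Real.exp_le_one_iff.2 (by linarith)
      rw [hD]
      simp only
      rw [norm_mul, norm_cexp_neg_mul hs, mul_comm]
      gcongr
      refine (norm_sub_le _ _).trans ?_
      rw [norm_mul, norm_mul, Complex.norm_real, Real.norm_eq_abs, abs_of_pos (Real.exp_pos _)]
      have : ‖s‖ * Real.exp (-x) * ‖∫ θ in (0 : ℝ)..α, f (polar x θ)‖ ≤ m * 1 * (C * |α|) := by
        gcongr
      have h1 : 0 ≤ m * C := by positivity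
      have h2 : 0 ≤ C * |α| := by positivity
      have h3 : 0 ≤ m * C * |α| := by positivity
      nlinarith
    have hder : ∀ x, 0 < x → HasDerivAt
        (fun x => densityPrimitive s f x α - densityPrimitive s f r α) (D x) x := fun x hx =>
      (hasDerivAt_densityPrimitive hf hx α).sub_const _
    set E := 2 * C * (1 + m) * (1 + |α|) with hE
    have hE0 : 0 ≤ E := by positivity
    -- The comparison function is the antiderivative of E e^{-x/2} that vanishes at x = r; it never
    -- exceeds 2 E e^{-r/2}.
    have := image_norm_le_of_norm_deriv_right_le_deriv_boundary
      (f := fun x => densityPrimitive s f x α - densityPrimitive s f r α) (f' := D)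
      (a := r) (b := r') (B := fun x => 2 * E * (Real.exp (-r / 2) - Real.exp (-x / 2)))
      (B' := fun x => E * Real.exp (-x / 2))
      (fun x hx => (hder x (hr.trans_le hx.1)).continuousAt.continuousWithinAt)
      (fun x hx => (hder x (hr.trans_le hx.1)).hasDerivWithinAt) (by simp)
      (fun x => by
        refine ((((hasDerivAt_neg x).div_const 2).exp.const_sub _).const_mul (2 * E)).congr_deriv ?_
        ring)
      (fun x hx => hDle x (hr.trans_le hx.1)) (right_mem_Icc.2 hrr')
    refine this.trans ?_
    have h1 := Real.exp_pos (-r' / 2)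
    calc 2 * E * (Real.exp (-r / 2) - Real.exp (-r' / 2)) ≤ 2 * E * Real.exp (-r / 2) := by
          gcongr; linarith
      _ = _ := by rw [hE]; ring

/-- The limit as `r → ∞` of the primitives of the density, with its rate of convergence. -/
lemma IsBoundedEigenfunction.exists_limit (hs : s.re = 1 / 2) (hf : IsBoundedEigenfunction s f) :
    ∃ D : ℝ → ℂ, (∀ α, Tendsto (fun r => densityPrimitive s f r α) atTop (𝓝 (D α))) ∧
      ∃ K : ℝ, 0 ≤ K ∧ (∀ r θ : ℝ, 0 ≤ r → ‖density s f r θ‖ ≤ K * Real.exp (r / 2)) ∧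
        ∀ r α : ℝ, 0 < r →
          ‖D α - densityPrimitive s f r α‖ ≤ K * (1 + |α|) * Real.exp (-r / 2) := by
  obtain ⟨K, hK, hdens, hdiff⟩ := hf.exists_density_bounds hs
  have hexp : Tendsto (fun r : ℝ => Real.exp (-r / 2)) atTop (𝓝 0) :=
    Real.tendsto_exp_atBot.comp ((tendsto_neg_atTop_atBot).atBot_div_const two_pos)
  have hcauchy : ∀ α, CauchySeq fun r => densityPrimitive s f r α := by
    intro α
    have h0 : Tendsto (fun r : ℝ => K * (1 + |α|) * Real.exp (-r / 2)) atTop (𝓝 0) := by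
      simpa using hexp.const_mul (K * (1 + |α|))
    refine Metric.cauchySeq_iff'.2 fun ε hε => ?_
    obtain ⟨N, hN, hN0⟩ := ((h0.eventually (gt_mem_nhds hε)).and (eventually_gt_atTop 0)).exists
    refine ⟨N, fun n hn => ?_⟩
    rw [dist_eq_norm]
    exact (hdiff N n α hN0 hn).trans_lt hN
  choose D hD using fun α => cauchySeq_tendsto_of_complete (hcauchy α)
  refine ⟨D, hD, K, hK, hdens, fun r α hr => ?_⟩
  refine le_of_tendsto ((hD α).sub_const _).norm ?_
  filter_upwards [eventually_ge_atTop r] with r' hr'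
  exact hdiff r r' α hr hr'

end Density

/-! ### Circular means and the normalizing constant -/

/-- Complex solutions of the radial equation for the eigenvalue `s (1 - s)`. -/
structure IsComplexRadialSolution (s : ℂ) (A A' A'' : ℝ → ℂ) : Prop where
  deriv_fst : ∀ r, HasDerivAt A (A' r) r
  deriv_snd : ∀ r, HasDerivAt A' (A'' r) r
  ode : ∀ r : ℝ, (Real.sinh r : ℂ) * A'' r + (Real.cosh r : ℂ) * A' r +
    s * (1 - s) * (Real.sinh r : ℂ) * A r = 0

/-- On the line Re s = 1/2 the eigenvalue is real and positive, so real and imaginary parts solve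
the radial equation separately and the energy argument applies to each. -/
lemma eigenvalue_eq {s : ℂ} (hs : s.re = 1 / 2) :
    s * (1 - s) = ((1 / 4 + s.im ^ 2 : ℝ) : ℂ) := by
  apply Complex.ext <;> simp [hs, pow_two] <;> ring

namespace IsComplexRadialSolution

variable {s : ℂ} {A A' A'' B B' B'' : ℝ → ℂ}

lemma re (h : IsComplexRadialSolution s A A' A'') (hs : s.re = 1 / 2) :
    IsRadialSolution (1 / 4 + s.im ^ 2) (fun r => (A r).re) (fun r => (A' r).re)
      (fun r => (A'' r).re) where
  deriv_fst r := Complex.reCLM.hasFDerivAt.comp_hasDerivAt r (h.deriv_fst r)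
  deriv_snd r := Complex.reCLM.hasFDerivAt.comp_hasDerivAt r (h.deriv_snd r)
  ode r := by
    have := congrArg Complex.re (h.ode r)
    rw [eigenvalue_eq hs, ← Complex.ofReal_mul] at this
    simpa only [Complex.add_re, Complex.re_ofReal_mul, Complex.zero_re] using this

lemma im (h : IsComplexRadialSolution s A A' A'') (hs : s.re = 1 / 2) :
    IsRadialSolution (1 / 4 + s.im ^ 2) (fun r => (A r).im) (fun r => (A' r).im)
      (fun r => (A'' r).im) where
  deriv_fst r := Complex.imCLM.hasFDerivAt.comp_hasDerivAt r (h.deriv_fst r)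
  deriv_snd r := Complex.imCLM.hasFDerivAt.comp_hasDerivAt r (h.deriv_snd r)
  ode r := by
    have := congrArg Complex.im (h.ode r)
    rw [eigenvalue_eq hs, ← Complex.ofReal_mul] at this
    simpa only [Complex.add_im, Complex.im_ofReal_mul, Complex.zero_im] using this

lemma eq_zero (h : IsComplexRadialSolution s A A' A'') (hs : s.re = 1 / 2) (h0 : A 0 = 0)
    {r : ℝ} (hr : 0 ≤ r) : A r = 0 ∧ A' r = 0 := by
  have hl : (0 : ℝ) < 1 / 4 + s.im ^ 2 := by positivity
  have h1 := (h.re hs).eq_zero hl (by simp [h0]) hr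
  have h2 := (h.im hs).eq_zero hl (by simp [h0]) hr
  exact ⟨Complex.ext h1.1 h2.1, Complex.ext h1.2 h2.2⟩

lemma sub_const_mul (h : IsComplexRadialSolution s A A' A'')
    (h' : IsComplexRadialSolution s B B' B'') (k : ℂ) :
    IsComplexRadialSolution s (fun r => A r - k * B r) (fun r => A' r - k * B' r)
      (fun r => A'' r - k * B'' r) where
  deriv_fst r := (h.deriv_fst r).sub ((h'.deriv_fst r).const_mul k)
  deriv_snd r := (h.deriv_snd r).sub ((h'.deriv_snd r).const_mul k)
  ode r := by linear_combination h.ode r - k * h'.ode r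

lemma const_mul (h : IsComplexRadialSolution s A A' A'') (k : ℂ) :
    IsComplexRadialSolution s (fun r => k * A r) (fun r => k * A' r) (fun r => k * A'' r) where
  deriv_fst r := (h.deriv_fst r).const_mul k
  deriv_snd r := (h.deriv_snd r).const_mul k
  ode r := by linear_combination k * h.ode r

/-- The outgoing component of a nonzero regular solution has a nonzero limit. -/
lemma limit_ne_zero (h : IsComplexRadialSolution s A A' A'') (hs : s.re = 1 / 2) (h0 : A 0 ≠ 0)
    {v : ℂ} (hv : Tendsto (fun r : ℝ => Complex.exp (-s * r) * (A' r + s * A r) *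
      (Real.sinh r : ℂ)) atTop (𝓝 v)) : v ≠ 0 := by
  rintro rfl
  -- After division by A 0 the solution equals 1 at the origin. Its imaginary part vanishes there,
  -- hence for all r ≥ 0, and the lower bound for real solutions applies to the real part.
  have hk := h.const_mul (A 0)⁻¹
  have hv' := (hv.const_mul (A 0)⁻¹).norm.pow 2
  simp only [mul_zero, norm_zero, ne_eq, OfNat.ofNat_ne_zero, not_false_eq_true, zero_pow] at hv'
  have him : ∀ {r : ℝ}, 0 ≤ r → _ := (hk.im hs).eq_zero (by positivity) (by simp [h0])
  obtain ⟨δ, hδ, R, hR⟩ := (hk.re hs).exists_le_outgoing (by simp [h0])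
  have hev : ∀ᶠ r : ℝ in atTop, δ ≤ ‖(A 0)⁻¹ * (Complex.exp (-s * r) * (A' r + s * A r) *
      (Real.sinh r : ℂ))‖ ^ 2 := by
    filter_upwards [eventually_ge_atTop R, eventually_ge_atTop 0] with r hrR hr0
    refine (hR r hrR).trans (le_of_eq ?_)
    obtain ⟨hi, hi'⟩ := him hr0
    have hx : (A 0)⁻¹ * A r = (((A 0)⁻¹ * A r).re : ℂ) := Complex.ext rfl (by simpa using hi)
    have hx' : (A 0)⁻¹ * A' r = (((A 0)⁻¹ * A' r).re : ℂ) :=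
      Complex.ext rfl (by simpa using hi')
    have hrw : (A 0)⁻¹ * (Complex.exp (-s * r) * (A' r + s * A r) * (Real.sinh r : ℂ)) =
        Complex.exp (-s * r) * ((((A 0)⁻¹ * A' r).re : ℂ) + s * (((A 0)⁻¹ * A r).re : ℂ)) *
          (Real.sinh r : ℂ) := by
      rw [← hx, ← hx']; ring
    rw [hrw, norm_mul, norm_mul, norm_cexp_neg_mul hs, mul_pow, mul_pow, Complex.norm_real,
      Real.norm_eq_abs, sq_abs, ← Complex.normSq_eq_norm_sq, IsRadialSolution.outgoing]
    generalize ((A 0)⁻¹ * A r).re = x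
    generalize ((A 0)⁻¹ * A' r).re = x'
    have he : Real.exp (-r / 2) ^ 2 = Real.exp (-r) := by
      rw [← Real.exp_nat_mul]; congr 1; push_cast; ring
    rw [he, Complex.normSq_apply]
    simp [hs]
    ring
  exact absurd (ge_of_tendsto hv' hev) (not_le.2 hδ)

end IsComplexRadialSolution

variable {s : ℂ} {f : ℂ → ℂ}

/-- At the origin ∂_r f depends linearly on the direction, so its circular mean vanishes. This is
the radial equation at r = 0. -/
lemma integral_map_bdry_eq_zero (L : ℂ →L[ℝ] ℂ) :
    ∫ θ in (0 : ℝ)..2 * Real.pi, L (bdry θ) = 0 := by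
  have hd : ∀ θ : ℝ, HasDerivAt (fun θ => L (-Complex.I * bdry θ)) (L (bdry θ)) θ := by
    intro θ
    refine (L.hasFDerivAt.comp_hasDerivAt θ ((hasDerivAt_bdry θ).const_mul
      (-Complex.I))).congr_deriv ?_
    rw [← mul_assoc, neg_mul, Complex.I_mul_I]
    simp
  rw [intervalIntegral.integral_eq_sub_of_hasDerivAt (fun θ _ => hd θ)
    ((L.continuous.comp continuous_bdry).intervalIntegrable _ _)]
  simp

/-- The circular means of an eigenfunction solve the radial equation. -/
lemma IsBoundedEigenfunction.exists_radial (hf : IsBoundedEigenfunction s f) :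
    ∃ A A' A'' : ℝ → ℂ, IsComplexRadialSolution s A A' A'' ∧ A 0 = 2 * Real.pi * f 0 ∧
      ∀ r : ℝ, densityPrimitive s f r (2 * Real.pi) =
        Complex.exp (-s * r) * (A' r + s * A r) * (Real.sinh r : ℂ) := by
  have hC := hf.contDiffOn
  have c0 := continuous_comp_polar hC.continuousOn
  have c1 := continuous_radialDeriv hC
  have c2 := continuous_radialSecond hC
  have d0 : ∀ r : ℝ, HasDerivAt (fun r => ∫ θ in (0 : ℝ)..2 * Real.pi, f (polar r θ))
      (∫ θ in (0 : ℝ)..2 * Real.pi, radialDeriv f r θ) r := fun r =>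
    hasDerivAt_integral_of_continuousOn (F := fun r θ => f (polar r θ)) (F' := radialDeriv f)
      isOpen_univ 0 _ c0.continuousOn c1.continuousOn (fun r _ θ => hasDerivAt_radial hC r θ)
      (mem_univ r)
  have d1 : ∀ r : ℝ, HasDerivAt (fun r => ∫ θ in (0 : ℝ)..2 * Real.pi, radialDeriv f r θ)
      (∫ θ in (0 : ℝ)..2 * Real.pi, radialSecond f r θ) r := fun r =>
    hasDerivAt_integral_of_continuousOn (F := radialDeriv f) (F' := radialSecond f)
      isOpen_univ 0 _ c1.continuousOn c2.continuousOn (fun r _ θ => hasDerivAt_radialDeriv hC r θ)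
      (mem_univ r)
  refine ⟨_, _, _, ⟨d0, d1, fun r => ?_⟩, ?_, fun r => ?_⟩
  · rcases eq_or_ne r 0 with rfl | hr
    · have : ∫ θ in (0 : ℝ)..2 * Real.pi, radialDeriv f 0 θ = 0 := by
        have h0 : ∀ θ, polar 0 θ = 0 := fun θ => by simp [polar]
        simp only [radialDeriv, h0]
        rw [intervalIntegral.integral_const_mul, integral_map_bdry_eq_zero, mul_zero]
      simp [this]
    · have hne : (Real.sinh r : ℂ) ≠ 0 := by
        exact_mod_cast fun h => hr (Real.sinh_eq_zero.1 h)
      have s0 := continuous_comp_polar_right hC.continuousOn r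
      have s1 := c1.uncurry_left r
      have s2 := c2.uncurry_left r
      have s3 := continuous_angularSecond_right hC r
      have hftc : ∫ θ in (0 : ℝ)..2 * Real.pi, angularSecond f 0 (Real.tanh (r / 2)) θ = 0 := by
        rw [intervalIntegral.integral_eq_sub_of_hasDerivAt
          (fun θ _ => hasDerivAt_angularDeriv hC r θ) (s3.intervalIntegrable _ _)]
        simp [angularDeriv, polar]
      have hint : ∫ θ in (0 : ℝ)..2 * Real.pi, angularSecond f 0 (Real.tanh (r / 2)) θ =
          ∫ θ in (0 : ℝ)..2 * Real.pi, (-(s * (1 - s)) * (Real.sinh r : ℂ) ^ 2 * f (polar r θ) -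
            (Real.sinh r : ℂ) ^ 2 * radialSecond f r θ -
            (Real.sinh r : ℂ) * (Real.cosh r : ℂ) * radialDeriv f r θ) :=
        intervalIntegral.integral_congr fun θ _ => by
          linear_combination hf.polar_equation r θ
      rw [hftc, intervalIntegral.integral_sub, intervalIntegral.integral_sub,
        intervalIntegral.integral_const_mul, intervalIntegral.integral_const_mul,
        intervalIntegral.integral_const_mul] at hint
      · apply mul_left_cancel₀ hne
        linear_combination hint
      · exact (continuous_const.mul s0).intervalIntegrable _ _
      · exact (continuous_const.mul s2).intervalIntegrable _ _
      · exact ((continuous_const.mul s0).sub (continuous_const.mul s2)).intervalIntegrable _ _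
      · exact (continuous_const.mul s1).intervalIntegrable _ _
  · simp [polar]
  · have s0 := continuous_comp_polar_right hC.continuousOn r
    have s1 := c1.uncurry_left r
    simp only [densityPrimitive, density_eq hC]
    rw [intervalIntegral.integral_mul_const, intervalIntegral.integral_const_mul,
      intervalIntegral.integral_add, intervalIntegral.integral_const_mul]
    · exact s1.intervalIntegrable _ _
    · exact (continuous_const.mul s0).intervalIntegrable _ _

/-- There is a constant `c ≠ 0` such that the total mass of the density tends to `c f(0)` for every
bounded eigenfunction `f`. -/
lemma exists_normalizing_constant (hs : s.re = 1 / 2) :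
    ∃ c : ℂ, c ≠ 0 ∧ ∀ f : ℂ → ℂ, IsBoundedEigenfunction s f →
      Tendsto (fun r => densityPrimitive s f r (2 * Real.pi)) atTop (𝓝 (c * f 0)) := by
  have hpi : (2 * Real.pi : ℂ) ≠ 0 := by exact_mod_cast Real.two_pi_pos.ne'
  -- Any eigenfunction with f₀(0) ≠ 0 can serve as reference and fixes c. If there were none, all
  -- total masses would vanish and every nonzero c would do, so no spherical function has to be
  -- constructed.
  by_cases hex : ∃ f₀ : ℂ → ℂ, IsBoundedEigenfunction s f₀ ∧ f₀ 0 ≠ 0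
  · obtain ⟨f₀, hf₀, hne⟩ := hex
    obtain ⟨B, B', B'', hB, hB0, hBd⟩ := hf₀.exists_radial
    obtain ⟨D, hD, -⟩ := hf₀.exists_limit hs
    have hlim := hD (2 * Real.pi)
    have hBne : B 0 ≠ 0 := by rw [hB0]; exact mul_ne_zero hpi hne
    have hv : D (2 * Real.pi) ≠ 0 := by
      refine hB.limit_ne_zero hs hBne ?_
      simpa only [hBd] using hlim
    refine ⟨D (2 * Real.pi) / f₀ 0, div_ne_zero hv hne, fun f hf => ?_⟩
    obtain ⟨A, A', A'', hA, hA0, hAd⟩ := hf.exists_radial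
    -- The difference of the circular means of f and of (f(0) / f₀(0)) f₀ vanishes at the origin,
    -- hence for all r ≥ 0.
    have hzero : ∀ {r : ℝ}, 0 ≤ r → _ := (hA.sub_const_mul hB (f 0 / f₀ 0)).eq_zero hs (by
      rw [hA0, hB0]; field_simp; ring)
    have := (hlim.const_mul (f 0 / f₀ 0)).congr' (f₂ := fun r =>
      densityPrimitive s f r (2 * Real.pi)) (by
      filter_upwards [eventually_ge_atTop 0] with r hr
      obtain ⟨h1, h2⟩ := hzero hr
      rw [hAd, hBd]
      linear_combination (-Complex.exp (-s * r) * (Real.sinh r : ℂ)) * (h2 + s * h1))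
    convert this using 2
    ring
  · push Not at hex
    refine ⟨1, one_ne_zero, fun f hf => ?_⟩
    obtain ⟨A, A', A'', hA, hA0, hAd⟩ := hf.exists_radial
    rw [hex f hf, mul_zero]
    refine tendsto_const_nhds.congr' ?_
    filter_upwards [eventually_ge_atTop 0] with r hr
    obtain ⟨h1, h2⟩ := hA.eq_zero hs (by rw [hA0, hex f hf, mul_zero]) hr
    rw [hAd, h1, h2]
    ring

/-! ### The primitive of the Helgason distribution -/

section Primitive

variable {s : ℂ} {f : ℂ → ℂ}

lemma partialPrimitive_eq (s c : ℂ) (f : ℂ → ℂ) (r α : ℝ) :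
    partialPrimitive s c f r α = 1 / c * densityPrimitive s f r α := rfl

/-- Pointwise convergence of the primitives, with an exponential rate. -/
lemma IsBoundedEigenfunction.primitive_estimates (hs : s.re = 1 / 2)
    (hf : IsBoundedEigenfunction s f) (c : ℂ) :
    (∀ α, Tendsto (fun r => partialPrimitive s c f r α) atTop (𝓝 (primitive s c f α))) ∧
      ∃ K : ℝ, 0 ≤ K ∧ (∀ r θ : ℝ, 0 ≤ r → ‖1 / c * density s f r θ‖ ≤ K * Real.exp (r / 2)) ∧
        ∀ r α : ℝ, 0 < r → ‖primitive s c f α - partialPrimitive s c f r α‖ ≤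
          K * (1 + |α|) * Real.exp (-r / 2) := by
  obtain ⟨D, hD, K, hK, hdens, hrate⟩ := hf.exists_limit hs
  have hlim : ∀ α, Tendsto (fun r => partialPrimitive s c f r α) atTop (𝓝 (1 / c * D α)) :=
    fun α => (hD α).const_mul (1 / c)
  have hP : ∀ α, primitive s c f α = 1 / c * D α := fun α => (hlim α).limUnder_eq
  refine ⟨fun α => by rw [hP]; exact hlim α, ‖1 / c‖ * K, by positivity, fun r θ hr => ?_,
    fun r α hr => ?_⟩
  · rw [norm_mul, mul_assoc]
    gcongr
    exact hdens r θ hr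
  · rw [hP, partialPrimitive_eq, ← mul_sub, norm_mul, mul_assoc, mul_assoc, ← mul_assoc K]
    gcongr
    exact hrate r α hr

lemma tendsto_exp_neg_half : Tendsto (fun r : ℝ => Real.exp (-r / 2)) atTop (𝓝 0) :=
  Real.tendsto_exp_atBot.comp (tendsto_neg_atTop_atBot.atBot_div_const two_pos)

lemma IsBoundedEigenfunction.tendstoUniformlyOn_primitive (hs : s.re = 1 / 2)
    (hf : IsBoundedEigenfunction s f) (c : ℂ) :
    TendstoUniformlyOn (partialPrimitive s c f) (primitive s c f) atTop
      (Icc 0 (2 * Real.pi)) := by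
  obtain ⟨-, K, hK, -, hrate⟩ := hf.primitive_estimates hs c
  refine Metric.tendstoUniformlyOn_iff.2 fun ε hε => ?_
  have h0 : Tendsto (fun r : ℝ => K * (1 + 2 * Real.pi) * Real.exp (-r / 2)) atTop (𝓝 0) := by
    simpa using tendsto_exp_neg_half.const_mul (K * (1 + 2 * Real.pi))
  filter_upwards [h0.eventually (gt_mem_nhds hε), eventually_gt_atTop 0] with r hr hr0 α hα
  rw [dist_eq_norm]
  refine (hrate r α hr0).trans_lt (lt_of_le_of_lt ?_ hr)
  rw [abs_of_nonneg hα.1]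
  gcongr
  exact hα.2

lemma IsBoundedEigenfunction.partialPrimitive_sub (hf : IsBoundedEigenfunction s f) (c : ℂ)
    (r α β : ℝ) : partialPrimitive s c f r α - partialPrimitive s c f r β =
      ∫ θ in β..α, 1 / c * density s f r θ := by
  have hc := continuous_density_right (s := s) hf.contDiffOn r
  rw [partialPrimitive, partialPrimitive, ← mul_sub, intervalIntegral.integral_const_mul,
    intervalIntegral.integral_interval_sub_left (hc.intervalIntegrable _ _)
      (hc.intervalIntegrable _ _)]

/-- Interpolation at a radius r depending on |α - β|: replacing the limit by the primitive at radius
r costs O(e^{-r/2}), and that primitive varies by O(e^{r/2} |α - β|). Both are O(|α - β|^{1/2}) when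
e^{-r} is comparable to |α - β|. -/
lemma IsBoundedEigenfunction.exists_holderOnWith_primitive (hs : s.re = 1 / 2)
    (hf : IsBoundedEigenfunction s f) (c : ℂ) :
    ∃ C : NNReal, HolderOnWith C (1 / 2) (primitive s c f) (Icc 0 (2 * Real.pi)) := by
  obtain ⟨-, K, hK, hdens, hrate⟩ := hf.primitive_estimates hs c
  have key : ∀ α ∈ Icc 0 (2 * Real.pi), ∀ β ∈ Icc 0 (2 * Real.pi),
      ‖primitive s c f α - primitive s c f β‖ ≤ 23 * K * |α - β| ^ (1 / 2 : ℝ) := by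
    intro α hα β hβ
    rcases eq_or_ne α β with rfl | hne
    · simp
    have hπ := Real.pi_lt_d2
    have hd0 : 0 < |α - β| := abs_pos.2 (sub_ne_zero.2 hne)
    have hd7 : |α - β| / 7 < 1 := by
      have : |α - β| ≤ 2 * Real.pi := by
        rw [abs_le]; constructor <;> linarith [hα.1, hα.2, hβ.1, hβ.2]
      linarith
    -- The radius is r = -2 log x, so that e^{-r/2} = x. Since 7 > 2π, x < 1 and r > 0. The final
    -- constant is 23 = 8 + 7 + 8, with 8 ≥ 1 + 2π at each endpoint and 7 from |α - β| = 7 x².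
    set x : ℝ := Real.sqrt (|α - β| / 7) with hx
    have hx0 : 0 < x := Real.sqrt_pos.2 (by positivity)
    have hxsq : x ^ 2 = |α - β| / 7 := Real.sq_sqrt (by positivity)
    have hx1 : x < 1 := by nlinarith
    have hr : 0 < -2 * Real.log x := by
      have := Real.log_neg hx0 hx1
      linarith
    have he : Real.exp (-(-2 * Real.log x) / 2) = x := by
      rw [show -(-2 * Real.log x) / 2 = Real.log x by ring, Real.exp_log hx0]
    have he' : Real.exp (-2 * Real.log x / 2) = x⁻¹ := by
      rw [show -2 * Real.log x / 2 = -Real.log x by ring, Real.exp_neg, Real.exp_log hx0]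
    generalize -2 * Real.log x = r at *
    have hrate' : ∀ γ ∈ Icc 0 (2 * Real.pi),
        ‖primitive s c f γ - partialPrimitive s c f r γ‖ ≤ 8 * K * x := by
      intro γ hγ
      refine (hrate r γ hr).trans ?_
      rw [he, abs_of_nonneg hγ.1, mul_comm 8 K]
      gcongr
      linarith [hγ.2]
    have hmid : ‖partialPrimitive s c f r α - partialPrimitive s c f r β‖ ≤ 7 * K * x := by
      rw [hf.partialPrimitive_sub]
      refine (intervalIntegral.norm_integral_le_of_norm_le_const
        (fun θ _ => hdens r θ hr.le)).trans (le_of_eq ?_)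
      rw [he', show |α - β| = 7 * x ^ 2 by rw [hxsq]; ring]
      field_simp
    have htri : ‖primitive s c f α - primitive s c f β‖ ≤
        ‖primitive s c f α - partialPrimitive s c f r α‖ +
        ‖partialPrimitive s c f r α - partialPrimitive s c f r β‖ +
        ‖primitive s c f β - partialPrimitive s c f r β‖ := by
      rw [norm_sub_rev (primitive s c f β)]
      refine le_trans (le_of_eq ?_) (norm_add₃_le)
      congr 1
      ring
    have hxle : x ≤ |α - β| ^ (1 / 2 : ℝ) := by
      rw [← Real.sqrt_eq_rpow, hx]
      exact Real.sqrt_le_sqrt (by linarith)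
    calc ‖primitive s c f α - primitive s c f β‖ ≤ 23 * K * x := by
          linarith [hrate' α hα, hrate' β hβ]
      _ ≤ _ := by gcongr
  refine ⟨Real.toNNReal (23 * K), fun α hα β hβ => ?_⟩
  rw [edist_dist, edist_dist, ENNReal.ofReal_rpow_of_nonneg dist_nonneg (by positivity),
    ← ENNReal.ofReal_coe_nnreal, Real.coe_toNNReal _ (by positivity : 0 ≤ 23 * K),
    ← ENNReal.ofReal_mul (by positivity)]
  refine ENNReal.ofReal_le_ofReal ?_
  have := key α hα β hβ
  rw [← dist_eq_norm, ← Real.dist_eq] at this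
  simpa using this

/-! ### Integration by parts against the density -/

lemma tendsto_tanh_half : Tendsto (fun r : ℝ => Real.tanh (r / 2)) atTop (𝓝 1) := by
  have h : ∀ r : ℝ, Real.tanh (r / 2) = (1 - Real.exp (-r)) / (1 + Real.exp (-r)) := by
    intro r
    have h1 := (Real.exp_pos (r / 2)).ne'
    have h2 : Real.exp (-r) = (Real.exp (r / 2))⁻¹ ^ 2 := by
      rw [← Real.exp_neg, ← Real.exp_nat_mul]; congr 1; push_cast; ring
    rw [Real.tanh_eq_sinh_div_cosh, Real.sinh_eq, Real.cosh_eq, h2, Real.exp_neg]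
    field_simp
  have he : Tendsto (fun r : ℝ => Real.exp (-r)) atTop (𝓝 0) := Real.tendsto_exp_neg_atTop_nhds_zero
  simp only [h]
  simpa [Pi.div_def] using (he.const_sub 1).div (he.const_add 1) (by norm_num)

lemma tendsto_polar (θ : ℝ) : Tendsto (fun r => polar r θ) atTop (𝓝 (bdry θ)) := by
  have := ((Complex.continuous_ofReal.tendsto 1).comp tendsto_tanh_half).mul_const (bdry θ)
  simpa [polar, Function.comp_def] using this

lemma dist_polar_bdry (r θ : ℝ) : dist (polar r θ) (bdry θ) = 1 - Real.tanh (r / 2) := by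
  have : polar r θ - bdry θ = ((-(1 - Real.tanh (r / 2)) : ℝ) : ℂ) * bdry θ := by
    rw [polar]; push_cast; ring
  rw [dist_eq_norm, this, norm_mul, norm_bdry, mul_one, Complex.norm_real, norm_neg,
    Real.norm_eq_abs, abs_of_pos]
  linarith [(tanh_half_mem r).2]

lemma bdry_mem_sphere (θ : ℝ) : bdry θ ∈ Metric.sphere (0 : ℂ) 1 := by simp

/-- The value of `∫ ψ D` over `[a, b]` given by integration by parts against the primitive `D`. -/
def stieltjes (D h : ℝ → ℂ) (a b : ℝ) : ℂ :=
  h b * D b - h a * D a - ∫ θ in a..b, deriv h θ * D θ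

/-- The density has no pointwise limit to use, but its primitive does. Integration by parts at
finite r puts the derivative on Ψ, and every remaining factor converges boundedly. -/
lemma IsBoundedEigenfunction.tendsto_integral_mul_density (hs : s.re = 1 / 2)
    (hf : IsBoundedEigenfunction s f) (c : ℂ) {Ψ : ℂ → ℂ} {U : Set ℂ} (hU : IsOpen U)
    (hSU : Metric.sphere 0 1 ⊆ U) (hΨ : ContDiffOn ℝ 1 Ψ U) (a b : ℝ) :
    Tendsto (fun r => 1 / c * ∫ θ in a..b, Ψ (polar r θ) * density s f r θ) atTop
      (𝓝 (stieltjes (primitive s c f) (fun t => Ψ (bdry t)) a b)) := by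
  obtain ⟨hlim, K, hK, -, hrate⟩ := hf.primitive_estimates hs c
  have hdc := fun r => continuous_density_right (s := s) hf.contDiffOn r
  have hcomp : IsCompact (Metric.sphere (0 : ℂ) 1) := isCompact_sphere 0 1
  -- A closed thickening of the circle inside U is compact, so the derivative of Ψ is bounded on it,
  -- and it contains the circles of all large radii.
  obtain ⟨δ, hδ, hδU⟩ := hcomp.exists_cthickening_subset_open hU hSU
  have hfd : ContinuousOn (fderiv ℝ Ψ) U := hΨ.continuousOn_fderiv_of_isOpen hU (by norm_num)
  obtain ⟨C, hC⟩ := (hcomp.cthickening (r := δ)).exists_bound_of_continuousOn (hfd.mono hδU)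
  have hC0 : 0 ≤ C := (norm_nonneg _).trans
    (hC (bdry 0) (Metric.self_subset_cthickening _ (bdry_mem_sphere 0)))
  have hnear : ∀ᶠ r in atTop, ∀ θ, polar r θ ∈ Metric.cthickening δ (Metric.sphere (0 : ℂ) 1) := by
    have h1 : ∀ᶠ r : ℝ in atTop, 1 - δ < Real.tanh (r / 2) :=
      tendsto_tanh_half.eventually (lt_mem_nhds (by linarith))
    filter_upwards [h1] with r hr θ
    refine Metric.mem_cthickening_of_dist_le _ (bdry θ) δ _ (bdry_mem_sphere θ) ?_
    rw [dist_polar_bdry]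
    linarith
  have hder : ∀ z ∈ U, HasFDerivAt Ψ (fderiv ℝ Ψ z) z := fun z hz =>
    ((hΨ.contDiffAt (hU.mem_nhds hz)).differentiableAt (by norm_num)).hasFDerivAt
  set u' : ℝ → ℝ → ℂ := fun r θ =>
    (Real.tanh (r / 2) : ℂ) * fderiv ℝ Ψ (polar r θ) (Complex.I * bdry θ) with hu'
  have hu'c : ∀ r, (∀ θ, polar r θ ∈ U) → Continuous (u' r) := by
    intro r hr
    have hp : Continuous fun θ => polar r θ := by unfold polar; fun_prop
    exact continuous_const.mul ((hfd.comp_continuous hp hr).clm_apply (by fun_prop))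
  have hparts : ∀ᶠ r in atTop, 1 / c * ∫ θ in a..b, Ψ (polar r θ) * density s f r θ =
      Ψ (polar r b) * partialPrimitive s c f r b - Ψ (polar r a) * partialPrimitive s c f r a -
        ∫ θ in a..b, u' r θ * partialPrimitive s c f r θ := by
    filter_upwards [hnear] with r hr
    have hrU : ∀ θ, polar r θ ∈ U := fun θ => hδU (hr θ)
    rw [← intervalIntegral.integral_mul_deriv_eq_deriv_mul (u := fun θ => Ψ (polar r θ))
      (v := partialPrimitive s c f r) (u' := u' r) (v' := fun θ => 1 / c * density s f r θ)]
    · rw [← intervalIntegral.integral_const_mul]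
      exact intervalIntegral.integral_congr fun θ _ => by ring
    · intro θ _
      have h1 : HasDerivAt (fun θ : ℝ => polar r θ)
          ((Real.tanh (r / 2) : ℂ) * (Complex.I * bdry θ)) θ := (hasDerivAt_bdry θ).const_mul _
      have h2 := (hder _ (hrU θ)).comp_hasDerivAt θ h1
      rwa [map_ofReal_mul] at h2
    · intro θ _
      exact (intervalIntegral.integral_hasDerivAt_right ((hdc r).intervalIntegrable _ _)
        (hdc r).aestronglyMeasurable.stronglyMeasurableAtFilter (hdc r).continuousAt).const_mul _
    · exact (hu'c r hrU).intervalIntegrable _ _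
    · exact (continuous_const.mul (hdc r)).intervalIntegrable _ _
  have hPc : ∀ r, Continuous (partialPrimitive s c f r) := fun r =>
    continuous_const.mul (intervalIntegral.continuous_primitive
      (fun _ _ => (hdc r).intervalIntegrable _ _) 0)
  have hΨlim : ∀ θ, Tendsto (fun r => Ψ (polar r θ)) atTop (𝓝 (Ψ (bdry θ))) := fun θ =>
    (hder _ (hSU (bdry_mem_sphere θ))).continuousAt.tendsto.comp (tendsto_polar θ)
  have hu'lim : ∀ θ, Tendsto (fun r => u' r θ) atTop (𝓝 (deriv (fun t => Ψ (bdry t)) θ)) := by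
    intro θ
    have hm := hSU (bdry_mem_sphere θ)
    have h1 : deriv (fun t => Ψ (bdry t)) θ =
        ((1 : ℝ) : ℂ) * fderiv ℝ Ψ (bdry θ) (Complex.I * bdry θ) := by
      rw [Complex.ofReal_one, one_mul]
      exact ((hder _ hm).comp_hasDerivAt θ (hasDerivAt_bdry θ)).deriv
    rw [h1]
    have h2 : Tendsto (fun r => fderiv ℝ Ψ (polar r θ)) atTop (𝓝 (fderiv ℝ Ψ (bdry θ))) :=
      (hfd.continuousAt (hU.mem_nhds hm)).tendsto.comp (tendsto_polar θ)
    exact ((Complex.continuous_ofReal.tendsto 1).comp tendsto_tanh_half).mul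
      (((ContinuousLinearMap.apply ℝ ℂ (Complex.I * bdry θ)).continuous.tendsto _).comp h2)
  have hint : Tendsto (fun r => ∫ θ in a..b, u' r θ * partialPrimitive s c f r θ) atTop
      (𝓝 (∫ θ in a..b, deriv (fun t => Ψ (bdry t)) θ * primitive s c f θ)) := by
    refine intervalIntegral.tendsto_integral_filter_of_dominated_convergence
      -- A majorant independent of r: the primitives at radii r ≥ 1 and 1 are both within K (1 +
      -- |θ|) of the limit.
      (fun θ => C * (‖partialPrimitive s c f 1 θ‖ + 2 * (K * (1 + |θ|)))) ?_ ?_ ?_ ?_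
    · filter_upwards [hnear] with r hr
      exact ((hu'c r fun θ => hδU (hr θ)).mul (hPc r)).aestronglyMeasurable
    · filter_upwards [hnear, eventually_ge_atTop 1] with r hr hr1
      refine Eventually.of_forall fun θ _ => ?_
      rw [norm_mul]
      have hu'le : ‖u' r θ‖ ≤ C := by
        have h1 : ‖fderiv ℝ Ψ (polar r θ) (Complex.I * bdry θ)‖ ≤ C := by
          refine (ContinuousLinearMap.le_of_opNorm_le _ (hC _ (hr θ)) _).trans ?_
          simp
        have h2 : |Real.tanh (r / 2)| ≤ 1 := (Real.abs_tanh_lt_one _).le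
        rw [hu', norm_mul, Complex.norm_real, Real.norm_eq_abs]
        calc |Real.tanh (r / 2)| * _ ≤ 1 * C := by gcongr
          _ = C := one_mul C
      have hle : ∀ x : ℝ, 1 ≤ x → ‖primitive s c f θ - partialPrimitive s c f x θ‖ ≤
          K * (1 + |θ|) := by
        intro x hx
        refine (hrate x θ (by linarith)).trans (mul_le_of_le_one_right (by positivity) ?_)
        exact Real.exp_le_one_iff.2 (by linarith)
      have hPle : ‖partialPrimitive s c f r θ‖ ≤
          ‖partialPrimitive s c f 1 θ‖ + 2 * (K * (1 + |θ|)) := by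
        have h3 : partialPrimitive s c f r θ = partialPrimitive s c f 1 θ +
            (primitive s c f θ - partialPrimitive s c f 1 θ) +
            -(primitive s c f θ - partialPrimitive s c f r θ) := by ring
        rw [h3]
        refine norm_add₃_le.trans ?_
        rw [norm_neg]
        linarith [hle 1 le_rfl, hle r hr1]
      gcongr
    · have h1 := (hPc 1).norm
      exact Continuous.intervalIntegrable (by fun_prop) _ _
    · exact Eventually.of_forall fun θ _ => (hu'lim θ).mul (hlim θ)
  refine Tendsto.congr' (hparts.mono fun r hr => hr.symm) ?_
  exact (((hΨlim b).mul (hlim b)).sub ((hΨlim a).mul (hlim a))).sub hint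

end Primitive

/-! ### Intervals of the circle -/

lemma bdry_eq_bdry_iff {x y : ℝ} : bdry x = bdry y ↔ ∃ n : ℤ, x = y + n * (2 * Real.pi) := by
  rw [bdry, bdry, Complex.exp_eq_exp_iff_exists_int]
  refine exists_congr fun n => ?_
  have : (y : ℂ) * Complex.I + n * (2 * Real.pi * Complex.I) =
      ((y + n * (2 * Real.pi) : ℝ) : ℂ) * Complex.I := by push_cast; ring
  rw [this, mul_left_inj' Complex.I_ne_zero, Complex.ofReal_inj]

lemma exists_bdry_eq {z : ℂ} (hz : ‖z‖ = 1) (a : ℝ) :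
    ∃ θ ∈ Ico a (a + 2 * Real.pi), bdry θ = z := by
  refine ⟨toIcoMod Real.two_pi_pos a z.arg, toIcoMod_mem_Ico _ _ _, ?_⟩
  rw [toIcoMod, bdry_periodic.sub_zsmul_eq]
  have := Complex.norm_mul_exp_arg_mul_I z
  rwa [hz, Complex.ofReal_one, one_mul] at this

lemma bdry_image_Icc_eq_sphere {a b : ℝ} (h : a + 2 * Real.pi ≤ b) :
    bdry '' Icc a b = Metric.sphere 0 1 := by
  apply Subset.antisymm
  · rintro _ ⟨θ, -, rfl⟩
    exact bdry_mem_sphere θ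
  · intro z hz
    obtain ⟨θ, hθ, rfl⟩ := exists_bdry_eq (by simpa using hz) a
    exact ⟨θ, ⟨hθ.1, hθ.2.le.trans h⟩, rfl⟩

/-- `I` is the image of an interval `J` with endpoints `a ≤ b ≤ a + 2π`. -/
structure IsArcOf (I : Set ℂ) (J : Set ℝ) (a b : ℝ) : Prop where
  le : a ≤ b
  le_add : b ≤ a + 2 * Real.pi
  ordConnected : J.OrdConnected
  Ioo_subset : Ioo a b ⊆ J
  subset_Icc : J ⊆ Icc a b
  eq_image : I = bdry '' J

lemma isArcOf_Icc {a b : ℝ} (h : a ≤ b) (h' : b ≤ a + 2 * Real.pi) :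
    IsArcOf (bdry '' Icc a b) (Icc a b) a b :=
  ⟨h, h', ordConnected_Icc, Ioo_subset_Icc_self, Subset.rfl, rfl⟩

/-- If J contains two points at distance at least 2π, its image is the whole circle and one closed
period replaces J. Otherwise inf J and sup J are the endpoints, at distance at most 2π. -/
lemma IsCircleInterval.eq_empty_or_isArcOf {I : Set ℂ} (hI : IsCircleInterval I) :
    I = ∅ ∨ ∃ J a b, IsArcOf I J a b := by
  obtain ⟨J, hJ, rfl⟩ := hI
  rcases J.eq_empty_or_nonempty with rfl | hne
  · simp
  right
  by_cases hlong : ∃ x ∈ J, ∃ y ∈ J, x + 2 * Real.pi ≤ y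
  · obtain ⟨x, hx, y, hy, hxy⟩ := hlong
    have heq : bdry '' J = bdry '' Icc x (x + 2 * Real.pi) := by
      rw [bdry_image_Icc_eq_sphere le_rfl]
      apply Subset.antisymm
      · rintro _ ⟨θ, -, rfl⟩
        exact bdry_mem_sphere θ
      · rw [← bdry_image_Icc_eq_sphere hxy]
        exact image_mono (hJ.out hx hy)
    rw [heq]
    exact ⟨_, _, _, isArcOf_Icc (by linarith [Real.pi_pos]) le_rfl⟩
  · push Not at hlong
    obtain ⟨x₀, hx₀⟩ := hne
    have hbb : BddBelow J := ⟨x₀ - 2 * Real.pi, fun x hx => by linarith [hlong x hx x₀ hx₀]⟩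
    have hba : BddAbove J := ⟨x₀ + 2 * Real.pi, fun y hy => (hlong x₀ hx₀ y hy).le⟩
    refine ⟨J, sInf J, sSup J, csInf_le_csSup ⟨x₀, hx₀⟩ hbb hba, ?_, hJ, ?_, ?_, rfl⟩
    · refine csSup_le ⟨x₀, hx₀⟩ fun y hy => ?_
      have : y - 2 * Real.pi ≤ sInf J := le_csInf ⟨x₀, hx₀⟩ fun x hx => by
        linarith [hlong x hx y hy]
      linarith
    · intro θ hθ
      obtain ⟨x, hx, hxθ⟩ := exists_lt_of_csInf_lt ⟨x₀, hx₀⟩ hθ.1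
      obtain ⟨y, hy, hyθ⟩ := exists_lt_of_lt_csSup ⟨x₀, hx₀⟩ hθ.2
      exact hJ.out hx hy ⟨hxθ.le, hyθ.le⟩
    · exact fun θ hθ => ⟨csInf_le hbb hθ, le_csSup hba hθ⟩

/-- A point of the circle determines its direction only when tanh (r / 2) ≠ 0, hence r > 0. -/
lemma polar_mem_arc_iff {I : Set ℂ} (hI : I ⊆ Metric.sphere 0 1) {r : ℝ} (hr : 0 < r) (θ : ℝ) :
    polar r θ ∈ arc r I ↔ bdry θ ∈ I := by
  have hT : 0 < Real.tanh (r / 2) := by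
    rw [Real.tanh_eq_sinh_div_cosh]
    exact div_pos (Real.sinh_pos_iff.2 (by positivity)) (Real.cosh_pos _)
  have hnorm : ‖polar r θ‖ = Real.tanh (r / 2) := by rw [norm_polar, abs_of_pos hT]
  constructor
  · rintro ⟨-, ξ, hξ, t, ht, he⟩
    have hξ1 : ‖ξ‖ = 1 := by simpa using hI hξ
    have ht' : t = Real.tanh (r / 2) := by
      have := congrArg norm he
      rwa [hnorm, norm_mul, hξ1, mul_one, Complex.norm_real, Real.norm_eq_abs,
        abs_of_nonneg ht.1, eq_comm] at this
    rw [ht', polar] at he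
    have := mul_left_cancel₀ (Complex.ofReal_ne_zero.2 hT.ne') he
    rwa [this]
  · intro h
    exact ⟨hnorm, bdry θ, h, Real.tanh (r / 2), ⟨hT.le, Real.tanh_lt_one _⟩, rfl⟩

lemma polar_periodic (r : ℝ) : Function.Periodic (polar r) (2 * Real.pi) := fun θ => by
  rw [polar, polar, bdry_periodic]

lemma density_periodic (s : ℂ) (f : ℂ → ℂ) (r : ℝ) :
    Function.Periodic (density s f r) (2 * Real.pi) := fun θ => by
  have h : ∀ ρ, polar ρ (θ + 2 * Real.pi) = polar ρ θ := fun ρ => polar_periodic ρ θ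
  simp only [density, normalDeriv, h]

/-- On an arc with endpoints `a ≤ b ≤ a + 2π` the arc integral is an integral over `[a, b]`. -/
lemma IsArcOf.arcIntegral_eq {I : Set ℂ} {J : Set ℝ} {a b : ℝ} (h : IsArcOf I J a b)
    (s : ℂ) (f Ψ : ℂ → ℂ) {r : ℝ} (hr : 0 < r) :
    arcIntegral s f I Ψ r = ∫ θ in a..b, Ψ (polar r θ) * density s f r θ := by
  have hI : I ⊆ Metric.sphere 0 1 := by
    rw [h.eq_image]
    rintro _ ⟨θ, -, rfl⟩
    exact bdry_mem_sphere θ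
  have hpi := Real.two_pi_pos
  set F : ℝ → ℂ := fun θ => Ψ (polar r θ) * density s f r θ with hF
  set T : Set ℝ := {θ | bdry θ ∈ I} with hT
  have hTmeas : MeasurableSet T := by
    have : T = ⋃ n : ℤ, (fun θ : ℝ => θ - n * (2 * Real.pi)) ⁻¹' J := by
      ext θ
      simp only [hT, mem_ofPred_eq, h.eq_image, mem_image, mem_iUnion, mem_preimage]
      constructor
      · rintro ⟨j, hj, he⟩
        obtain ⟨n, hn⟩ := bdry_eq_bdry_iff.1 he.symm
        exact ⟨n, by rw [hn]; simpa using hj⟩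
      · rintro ⟨n, hn⟩
        exact ⟨_, hn, bdry_eq_bdry_iff.2 ⟨-n, by push_cast; ring⟩⟩
    rw [this]
    exact MeasurableSet.iUnion fun n => h.ordConnected.measurableSet.preimage (by fun_prop)
  -- Periodicity lets the window (0, 2π] be moved to (a, a + 2π], in which the arc is a single
  -- interval up to null sets, even if it crosses the angle 0.
  have hper : Function.Periodic (T.indicator F) (2 * Real.pi) := by
    intro θ
    have h1 : F (θ + 2 * Real.pi) = F θ := by
      simp only [hF]; rw [polar_periodic, density_periodic]
    have h2 : θ + 2 * Real.pi ∈ T ↔ θ ∈ T := by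
      simp only [hT, mem_ofPred_eq]; rw [bdry_periodic]
    by_cases hθ : θ ∈ T
    · rw [indicator_of_mem hθ, indicator_of_mem (h2.2 hθ), h1]
    · rw [indicator_of_notMem hθ, indicator_of_notMem (mt h2.1 hθ)]
  have hset : {θ : ℝ | θ ∈ Ioc 0 (2 * Real.pi) ∧ polar r θ ∈ arc r I} =
      Ioc 0 (2 * Real.pi) ∩ T := by
    ext θ
    simp only [mem_ofPred_eq, mem_inter_iff, polar_mem_arc_iff hI hr, hT]
  have hae : (Ioc a (a + 2 * Real.pi) ∩ T : Set ℝ) =ᵐ[MeasureTheory.volume] Ioc a b := by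
    -- The two exceptional points are b, which J may omit, and a + 2π, which represents the same
    -- direction as a.
    have hfin : ∀ᵐ θ : ℝ, θ ∉ ({b, a + 2 * Real.pi} : Set ℝ) :=
      MeasureTheory.measure_eq_zero_iff_ae_notMem.1 ((Set.toFinite _).measure_zero _)
    filter_upwards [hfin] with θ hθ
    simp only [mem_insert_iff, mem_singleton_iff, not_or] at hθ
    refine propext ⟨?_, ?_⟩
    · rintro ⟨hθ1, hθT⟩
      refine ⟨hθ1.1, ?_⟩
      have hθlt : θ < a + 2 * Real.pi := lt_of_le_of_ne hθ1.2 hθ.2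
      simp only [hT, mem_ofPred_eq, h.eq_image] at hθT
      obtain ⟨j, hj, he⟩ := hθT
      obtain ⟨n, hn⟩ := bdry_eq_bdry_iff.1 he.symm
      have hj' := h.subset_Icc hj
      have hba := h.le_add
      have hn1 : n < 1 := by
        by_contra! hcon
        have : (1 : ℝ) ≤ n := by exact_mod_cast hcon
        nlinarith [hj'.1]
      have hn2 : -1 < n := by
        by_contra! hcon
        have : (n : ℝ) ≤ -1 := by exact_mod_cast hcon
        nlinarith [hj'.2, hθ1.1]
      have hn0 : n = 0 := by omega
      rw [hn, hn0]
      simpa using hj'.2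
    · intro hθ1
      refine ⟨⟨hθ1.1, hθ1.2.trans h.le_add⟩, ?_⟩
      simp only [hT, mem_ofPred_eq, h.eq_image]
      exact ⟨θ, h.Ioo_subset ⟨hθ1.1, lt_of_le_of_ne hθ1.2 hθ.1⟩, rfl⟩
  calc arcIntegral s f I Ψ r = ∫ θ in Ioc 0 (2 * Real.pi) ∩ T, F θ := by
        rw [arcIntegral, hset]
    _ = ∫ θ in (0 : ℝ)..0 + 2 * Real.pi, T.indicator F θ := by
        rw [intervalIntegral.integral_of_le (by linarith),
          MeasureTheory.setIntegral_indicator hTmeas, zero_add]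
    _ = ∫ θ in a..a + 2 * Real.pi, T.indicator F θ := hper.intervalIntegral_add_eq 0 a
    _ = ∫ θ in Ioc a (a + 2 * Real.pi) ∩ T, F θ := by
        rw [intervalIntegral.integral_of_le (by linarith),
          MeasureTheory.setIntegral_indicator hTmeas]
    _ = ∫ θ in Ioc a b, F θ := MeasureTheory.setIntegral_congr_set hae
    _ = _ := (intervalIntegral.integral_of_le h.le).symm

/-! ### Extension of `C¹` functions -/

/-- A `C¹` function on a compact interval extends to a `C¹` function on the line. -/
lemma exists_contDiff_extension {g : ℝ → ℂ} {a b : ℝ} (hab : a < b)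
    (hg : ContDiffOn ℝ 1 g (Icc a b)) : ∃ G : ℝ → ℂ, ContDiff ℝ 1 G ∧ EqOn G g (Icc a b) := by
  have hcont : ContinuousOn (derivWithin g (Icc a b)) (Icc a b) :=
    hg.continuousOn_derivWithin (uniqueDiffOn_Icc hab) le_rfl
  -- The one-sided derivative is continued by its endpoint values; integrating this continuous
  -- function gives the C¹ extension.
  set k : ℝ → ℂ := IccExtend hab.le ((Icc a b).domRestrict (derivWithin g (Icc a b))) with hk
  have hkc : Continuous k := (continuousOn_iff_continuous_domRestrict.1 hcont).Icc_extend'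
  have hd : ∀ θ, HasDerivAt (fun θ => g a + ∫ t in a..θ, k t) (k θ) θ := fun θ =>
    (intervalIntegral.integral_hasDerivAt_right (hkc.intervalIntegrable _ _)
      hkc.aestronglyMeasurable.stronglyMeasurableAtFilter hkc.continuousAt).const_add _
  refine ⟨fun θ => g a + ∫ t in a..θ, k t, ?_, fun θ hθ => ?_⟩
  · rw [contDiff_one_iff_deriv]
    refine ⟨fun θ => (hd θ).differentiableAt, ?_⟩
    rw [show deriv (fun θ => g a + ∫ t in a..θ, k t) = k from funext fun θ => (hd θ).deriv]
    exact hkc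
  · have hftc := intervalIntegral.integral_eq_sub_of_hasDerivAt_of_le (f := g) (f' := k) hθ.1
      (hg.continuousOn.mono (Icc_subset_Icc_right hθ.2)) (fun x hx => by
        have hx' : x ∈ Ioo a b := ⟨hx.1, hx.2.trans_le hθ.2⟩
        have hkx : k x = derivWithin g (Icc a b) x := by
          rw [hk, IccExtend_of_mem _ _ (Ioo_subset_Icc_self hx')]
          rfl
        rw [hkx]
        exact ((hg.differentiableOn (by norm_num) x
          (Ioo_subset_Icc_self hx')).hasDerivWithinAt).hasDerivAt (Icc_mem_nhds hx'.1 hx'.2))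
      (hkc.intervalIntegrable _ _)
    simp only [hftc]
    ring

lemma contDiffOn_arg : ContDiffOn ℝ 1 Complex.arg Complex.slitPlane := by
  intro z hz
  have h := (Complex.contDiffAt_log hz (n := 1)).restrict_scalars ℝ
  have h2 := Complex.imCLM.contDiff.contDiffAt.comp z h
  rw [show Complex.arg = ⇑Complex.imCLM ∘ Complex.log from
    funext fun w => (Complex.log_im w).symm]
  exact h2.contDiffWithinAt

/-- Extension of a `C¹` function from an arc of length less than `2π`. -/
lemma exists_contDiff_extension_arc {φ : ℂ → ℂ} {a b : ℝ} (hab : a < b) (hb : b < a + 2 * Real.pi)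
    (hφ : ContDiffOn ℝ 1 φ (bdry '' Icc a b)) :
    ∃ Ψ : ℂ → ℂ, ContDiff ℝ 1 Ψ ∧ EqOn Ψ φ (bdry '' Icc a b) := by
  obtain ⟨G, hG, hGe⟩ := exists_contDiff_extension hab
    (hφ.comp (contDiff_bdry (n := 1)).contDiffOn (mapsTo_image bdry (Icc a b)))
  -- Rotating the midpoint of the arc to 1 puts its angles in (-π, π), since the half-length is less
  -- than π. There arg is smooth and inverts the parametrization.
  set m : ℝ := (a + b) / 2 with hm
  have hbm := bdry_ne_zero m
  set V : Set ℂ := (fun z => z / bdry m) ⁻¹' Complex.slitPlane with hV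
  have hdiv : ContDiff ℝ 1 (fun z : ℂ => z / bdry m) := contDiff_id.div_const _
  have hVo : IsOpen V := Complex.isOpen_slitPlane.preimage hdiv.continuous
  have harg : ∀ θ ∈ Icc a b, (bdry θ / bdry m).arg = θ - m := by
    intro θ hθ
    have h1 : bdry θ / bdry m = Complex.exp (((θ - m : ℝ) : ℂ) * Complex.I) := by
      rw [bdry, bdry, ← Complex.exp_sub]; push_cast; ring_nf
    rw [h1, Complex.exp_mul_I]
    refine Complex.arg_cos_add_sin_mul_I ⟨?_, ?_⟩ <;> rw [hm] <;> linarith [hθ.1, hθ.2]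
  have hKV : bdry '' Icc a b ⊆ V := by
    rintro _ ⟨θ, hθ, rfl⟩
    simp only [hV, mem_preimage, Complex.mem_slitPlane_iff_arg]
    refine ⟨?_, div_ne_zero (bdry_ne_zero θ) hbm⟩
    rw [harg θ hθ]
    apply ne_of_lt
    rw [hm]
    linarith [hθ.1, hθ.2]
  have hK : IsCompact (bdry '' Icc a b) := isCompact_Icc.image continuous_bdry
  -- The cutoff is 1 near the arc and vanishes near the cut of arg, so the product is C¹ everywhere.
  obtain ⟨χ, hχ0, hχ1, -⟩ := exists_contMDiffMap_zero_one_nhds_of_isClosed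
    (modelWithCornersSelf ℝ ℂ) (n := 1) hVo.isClosed_compl hK.isClosed
    (disjoint_compl_left_iff_subset.2 hKV)
  have hχ : ContDiff ℝ 1 χ := χ.contMDiff.contDiff
  refine ⟨fun z => χ z • G (m + (z / bdry m).arg), ?_, ?_⟩
  · rw [contDiff_iff_contDiffAt]
    intro z
    by_cases hz : z ∈ V
    · have h1 : ContDiffAt ℝ 1 (fun z : ℂ => (z / bdry m).arg) z :=
        ContDiffAt.comp (g := Complex.arg) z
          (contDiffOn_arg.contDiffAt (Complex.isOpen_slitPlane.mem_nhds hz)) hdiv.contDiffAt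
      have h2 : ContDiffAt ℝ 1 (fun z : ℂ => G (m + (z / bdry m).arg)) z :=
        hG.contDiffAt.comp z (contDiffAt_const.add h1)
      exact hχ.contDiffAt.smul h2
    · have h0 : ∀ᶠ w in 𝓝 z, χ w = 0 := Filter.Eventually.filter_mono
        (nhds_le_nhdsSet (by exact hz)) hχ0
      refine (contDiffAt_const (c := (0 : ℂ))).congr_of_eventuallyEq ?_
      filter_upwards [h0] with w hw
      rw [hw, zero_smul]
  · rintro _ ⟨θ, hθ, rfl⟩
    have h1 : χ (bdry θ) = 1 := hχ1.self_of_nhdsSet _ (mem_image_of_mem _ hθ)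
    simp only [h1, one_smul, harg θ hθ, add_sub_cancel]
    exact hGe hθ

/-- Radial extension of a `C¹` function on the whole circle. -/
lemma exists_extension_sphere {φ : ℂ → ℂ} (hφ : ContDiffOn ℝ 1 φ (Metric.sphere 0 1)) :
    ContDiffOn ℝ 1 (fun z : ℂ => φ (‖z‖⁻¹ • z)) {0}ᶜ ∧
      EqOn (fun z : ℂ => φ (‖z‖⁻¹ • z)) φ (Metric.sphere 0 1) := by
  constructor
  · have h1 : ContDiffOn ℝ 1 (fun z : ℂ => ‖z‖⁻¹ • z) {0}ᶜ := by
      refine ContDiffOn.smul (ContDiffOn.inv (contDiffOn_id.norm ℝ fun z hz => hz) ?_) contDiffOn_id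
      exact fun z hz => norm_ne_zero_iff.2 hz
    refine hφ.comp h1 fun z hz => ?_
    have : ‖z‖ ≠ 0 := norm_ne_zero_iff.2 hz
    simp [this]
  · intro z hz
    have : ‖z‖ = 1 := by simpa using hz
    simp [this]

lemma IsArcOf.image_Icc_subset_closure {I : Set ℂ} {J : Set ℝ} {a b : ℝ} (h : IsArcOf I J a b)
    (hab : a < b) : bdry '' Icc a b ⊆ closure I := by
  rw [h.eq_image, ← closure_Ioo hab.ne]
  exact (image_closure_subset_closure_image continuous_bdry).trans
    (closure_mono (image_mono h.Ioo_subset))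

lemma IsArcOf.subset_image_Icc {I : Set ℂ} {J : Set ℝ} {a b : ℝ} (h : IsArcOf I J a b) :
    I ⊆ bdry '' Icc a b := by
  rw [h.eq_image]
  exact image_mono h.subset_Icc

/-- `C¹` functions on the closure of an arc have `C¹` extensions near the circle. -/
lemma IsArcOf.exists_extension {I : Set ℂ} {J : Set ℝ} {a b : ℝ} (h : IsArcOf I J a b)
    {ψ : ℂ → ℂ} (hψ : IsC1OnClosure I ψ) : ∃ Ψ, IsC1Extension I ψ Ψ := by
  obtain ⟨φ, hφ, hφψ⟩ := hψ
  -- A degenerate interval is at most one point, and a constant extends ψ.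
  rcases h.le.eq_or_lt with rfl | hab
  · refine ⟨fun _ => ψ (bdry a), ⟨univ, isOpen_univ, subset_univ _, contDiffOn_const⟩, ?_⟩
    intro z hz
    obtain ⟨θ, hθ, rfl⟩ := h.subset_image_Icc hz
    rw [Icc_self, mem_singleton_iff] at hθ
    rw [hθ]
  have hφ' := hφ.mono (h.image_Icc_subset_closure hab)
  -- A full turn leaves no room for a cut of arg; there the closure is the whole circle and the
  -- radial extension is used.
  rcases h.le_add.eq_or_lt with hb | hb
  · rw [bdry_image_Icc_eq_sphere hb.ge] at hφ'
    obtain ⟨h1, h2⟩ := exists_extension_sphere hφ'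
    refine ⟨_, ⟨{0}ᶜ, isOpen_compl_singleton, ?_, h1⟩, fun z hz => ?_⟩
    · intro z hz h0
      rw [mem_singleton_iff.1 h0] at hz
      simp at hz
    · have := h.subset_image_Icc hz
      rw [bdry_image_Icc_eq_sphere hb.ge] at this
      exact (h2 this).trans (hφψ hz)
  · obtain ⟨Ψ, hΨ, hΨe⟩ := exists_contDiff_extension_arc hab hb hφ'
    exact ⟨Ψ, ⟨univ, isOpen_univ, subset_univ _, hΨ.contDiffOn⟩, fun z hz =>
      (hΨe (h.subset_image_Icc hz)).trans (hφψ hz)⟩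

/-! ### The Helgason integral -/

/-- Two functions that agree on `(a, b)` and at both endpoints have the same Stieltjes integral. -/
lemma stieltjes_congr {D h h' : ℝ → ℂ} {a b : ℝ} (hab : a ≤ b) (hh : EqOn h h' (Icc a b)) :
    stieltjes D h a b = stieltjes D h' a b := by
  rw [stieltjes, stieltjes, hh (left_mem_Icc.2 hab), hh (right_mem_Icc.2 hab)]
  congr 1
  -- At the endpoints `deriv` also sees values outside [a, b] and may differ for the two functions,
  -- so these two points are discarded as a null set.
  rw [intervalIntegral.integral_of_le hab, intervalIntegral.integral_of_le hab,
    MeasureTheory.integral_Ioc_eq_integral_Ioo, MeasureTheory.integral_Ioc_eq_integral_Ioo]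
  refine MeasureTheory.setIntegral_congr_fun measurableSet_Ioo fun θ hθ => ?_
  have : h =ᶠ[𝓝 θ] h' := by
    filter_upwards [Icc_mem_nhds hθ.1 hθ.2] with x hx using hh hx
  simp only [this.deriv_eq]

variable {s : ℂ} {f : ℂ → ℂ}

lemma IsBoundedEigenfunction.tendsto_arcIntegral (hs : s.re = 1 / 2)
    (hf : IsBoundedEigenfunction s f) (c : ℂ) {I : Set ℂ} {J : Set ℝ} {a b : ℝ}
    (h : IsArcOf I J a b) {ψ Ψ : ℂ → ℂ} (hΨ : IsC1Extension I ψ Ψ) :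
    Tendsto (fun r : ℝ => 1 / c * arcIntegral s f I Ψ r) atTop
      (𝓝 (stieltjes (primitive s c f) (fun t => Ψ (bdry t)) a b)) := by
  obtain ⟨⟨U, hU, hSU, hΨU⟩, -⟩ := hΨ
  refine (hf.tendsto_integral_mul_density hs c hU hSU hΨU a b).congr' ?_
  filter_upwards [eventually_gt_atTop 0] with r hr
  rw [h.arcIntegral_eq s f Ψ hr]

/-- Two extensions have the same Stieltjes integral. -/
lemma IsArcOf.stieltjes_eq {I : Set ℂ} {J : Set ℝ} {a b : ℝ} (h : IsArcOf I J a b)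
    {ψ Ψ Ψ' : ℂ → ℂ} (hΨ : IsC1Extension I ψ Ψ) (hΨ' : IsC1Extension I ψ Ψ') (D : ℝ → ℂ) :
    stieltjes D (fun t => Ψ (bdry t)) a b = stieltjes D (fun t => Ψ' (bdry t)) a b := by
  rcases h.le.eq_or_lt with rfl | hab
  · simp [stieltjes]
  have hcont : ∀ {Φ : ℂ → ℂ}, IsC1Extension I ψ Φ → Continuous fun t => Φ (bdry t) := by
    rintro Φ ⟨⟨U, -, hSU, hΦU⟩, -⟩
    exact hΦU.continuousOn.comp_continuous continuous_bdry fun t => hSU (bdry_mem_sphere t)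
  refine stieltjes_congr hab.le ?_
  have heq : EqOn (fun t => Ψ (bdry t)) (fun t => Ψ' (bdry t)) (Ioo a b) := by
    intro t ht
    have hm : bdry t ∈ I := by
      rw [h.eq_image]
      exact mem_image_of_mem _ (h.Ioo_subset ht)
    exact (hΨ.2 hm).trans (hΨ'.2 hm).symm
  -- Continuity carries the agreement to endpoints that J may omit.
  have := heq.closure (hcont hΨ) (hcont hΨ')
  rwa [closure_Ioo hab.ne] at this

lemma IsBoundedEigenfunction.isHelgasonIntegral (hs : s.re = 1 / 2)
    (hf : IsBoundedEigenfunction s f) (c : ℂ) {I : Set ℂ} {J : Set ℝ} {a b : ℝ}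
    (h : IsArcOf I J a b) {ψ Ψ : ℂ → ℂ} (hΨ : IsC1Extension I ψ Ψ) :
    IsHelgasonIntegral s c f I ψ (stieltjes (primitive s c f) (fun t => Ψ (bdry t)) a b) :=
  ⟨⟨Ψ, hΨ⟩, fun Ψ' hΨ' => by
    rw [h.stieltjes_eq hΨ hΨ']
    exact hf.tendsto_arcIntegral hs c h hΨ'⟩

lemma isHelgasonIntegral_empty (s c : ℂ) (f ψ : ℂ → ℂ) : IsHelgasonIntegral s c f ∅ ψ 0 := by
  refine ⟨⟨fun _ => 0, ⟨univ, isOpen_univ, subset_univ _, contDiffOn_const⟩, by simp⟩,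
    fun Ψ _ => ?_⟩
  have : ∀ r, arcIntegral s f ∅ Ψ r = 0 := fun r => by simp [arcIntegral, arc]
  simp [this]

/-- The existence clause in `IsHelgasonIntegral` is what makes this true: without an extension the
limit condition would hold vacuously for every value. -/
lemma IsHelgasonIntegral.unique {c : ℂ} {I : Set ℂ} {ψ : ℂ → ℂ} {L L' : ℂ}
    (h : IsHelgasonIntegral s c f I ψ L) (h' : IsHelgasonIntegral s c f I ψ L') : L = L' := by
  obtain ⟨Ψ, hΨ⟩ := h.1
  exact tendsto_nhds_unique (h.2 Ψ hΨ) (h'.2 Ψ hΨ)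

end HelgasonDisk

end

open HelgasonDisk in
theorem proposition2p2 (s : ℂ) (hs : s.re = 1 / 2) :
    ∃ c : ℂ, IsNormalizing s c ∧ ∀ f : ℂ → ℂ, IsBoundedEigenfunction s f →
      -- the primitive exists as a uniform limit on `[0, 2π]` and is `1/2`-Hölder there
      (TendstoUniformlyOn (partialPrimitive s c f) (primitive s c f) atTop
          (Icc 0 (2 * Real.pi)) ∧
        ∃ C : NNReal, HolderOnWith C (1 / 2) (primitive s c f) (Icc 0 (2 * Real.pi))) ∧
      -- the limit defining `∫ ψ 1_I D_{f,s}` exists and does not depend on the extension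
      (∀ (I : Set ℂ) (ψ : ℂ → ℂ), IsCircleInterval I → IsC1OnClosure I ψ →
        ∃! L : ℂ, IsHelgasonIntegral s c f I ψ L) ∧
      -- integration by parts
      (∀ (α β : ℝ) (ψ : ℂ → ℂ), 0 ≤ α → α < β → β ≤ 2 * Real.pi →
        IsC1OnClosure (bdry '' Icc α β) ψ →
        IsHelgasonIntegral s c f (bdry '' Icc α β) ψ
          (ψ (bdry β) * primitive s c f β - ψ (bdry α) * primitive s c f α -
            ∫ θ in α..β, deriv (fun t : ℝ => ψ (bdry t)) θ * primitive s c f θ)) := by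
  obtain ⟨c, hc, hlim⟩ := exists_normalizing_constant hs
  refine ⟨c, ⟨hc, fun f hf => ?_⟩, fun f hf => ⟨⟨hf.tendstoUniformlyOn_primitive hs c,
    hf.exists_holderOnWith_primitive hs c⟩, fun I ψ hI hψ => ?_, fun α β ψ hα hαβ hβ hψ => ?_⟩⟩
  · have harc := isArcOf_Icc (a := 0) (b := 2 * Real.pi) Real.two_pi_pos.le (by simp)
    rw [bdry_image_Icc_eq_sphere (by simp)] at harc
    have hext : IsC1Extension (Metric.sphere 0 1) (fun _ => 1) (fun _ => 1) :=
      ⟨⟨univ, isOpen_univ, subset_univ _, contDiffOn_const⟩, fun _ _ => rfl⟩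
    have h := hf.isHelgasonIntegral hs c harc hext
    have hpl := (hf.primitive_estimates hs c).1
    have h0 : primitive s c f 0 = 0 :=
      tendsto_nhds_unique (hpl 0) (by simp [partialPrimitive])
    have h1 : primitive s c f (2 * Real.pi) = f 0 := by
      refine tendsto_nhds_unique (hpl (2 * Real.pi)) ?_
      have := (hlim f hf).const_mul (1 / c)
      rwa [← mul_assoc, one_div_mul_cancel hc, one_mul] at this
    simpa [stieltjes, h0, h1] using h
  · rcases hI.eq_empty_or_isArcOf with rfl | ⟨J, a, b, harc⟩
    · exact ⟨0, isHelgasonIntegral_empty s c f ψ,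
        fun L hL => hL.unique (isHelgasonIntegral_empty s c f ψ)⟩
    · obtain ⟨Ψ, hΨ⟩ := harc.exists_extension hψ
      have h := hf.isHelgasonIntegral hs c harc hΨ
      exact ⟨_, h, fun L hL => hL.unique h⟩
  · have harc := isArcOf_Icc hαβ.le (by linarith : β ≤ α + 2 * Real.pi)
    obtain ⟨Ψ, hΨ⟩ := harc.exists_extension hψ
    have h := hf.isHelgasonIntegral hs c harc hΨ
    -- The extension agrees with ψ on the whole closed arc, so ψ itself may be written in the
    -- formula, whatever its values elsewhere.
    rwa [stieltjes_congr (h' := fun t => ψ (bdry t)) hαβ.le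
      (fun t ht => hΨ.2 (mem_image_of_mem _ ht))] at h
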